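/- Links are unoriented and are represented by diagrams, considered up to planar isotopy and Reidemeister moves. A $3$-move (or $(-3)$-move) replaces two parallel arcs of a diagram by three positive (or negative) half twists; two diagrams are $3$-move equivalent if they are related by a finite sequence of $\pm3$-moves, their inverses and Reidemeister moves. Let $T_n$ be the trivial link of $n$ components. The core group $\Pi(D)$ of a diagram $D$ has the arcs of $D$ as generators and a relation $c=ab^{-1}a$ for each crossing, where $a$ is the overcrossing and $b,c$ are the undercrossings. Putting one arc $e$ equal to $1$ in $\Pi(D)$ gives (the core presentation of) the fundamental group $\Pi(D)/\langle\langle e\rangle\rangle$ of the double branched cover of the link. The third Burnside group $B_L(3)$ of the link $L$ of $D$ is the quotient of this group by all relations $a^3=1$; its unreduced version $\hat B_L(3)$ is the quotient of $\Pi(D)$ by all relations $a^3=1$. Let $B(4,3)$ be the quotient of the free group on $x,y,z,t$ by all cubes. Let $\hat\gamma$ (Chen's link) be the closure of the $5$-braid $(\sigma_1^{-1}\sigma_2\sigma_3\sigma_4^{-1}\sigma_3)^4$. Then: 1. $\hat\gamma$ is $3$-move equivalent to the closure of $\Delta_5^4=(\sigma_1\sigma_2\sigma_3\sigma_4)^{10}$.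 2. If two diagrams are $3$-move equivalent, then their groups $\hat B(3)$ are isomorphic, and so are their groups $B(3)$, whatever arcs are put equal to $1$. 3. The element $P=uwtu^{-1}w^{-1}t^{-1}$, where $u=xy^{-1}zt^{-1}$ and $w=x^{-1}yz^{-1}t$, is nontrivial in $B(4,3)$, and there is a surjective homomorphism $B(4,3)\to B_{\hat\gamma}(3)$ that sends $P$ to $1$. 4. For every $n\ge 0$, $\hat B_{\hat\gamma}(3)\not\cong \hat B_{T_n}(3)$, and (for $n\ge1$) $B_{\hat\gamma}(3)\not\cong B_{T_n}(3)$. 5. For every $n$, $\hat\gamma$ is not $3$-move equivalent to $T_n$. In particular the Montesinos–Nakanishi conjecture, that every link is $3$-move equivalent to a trivial link, is false. -/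

import Mathlib

/-! Unoriented link diagrams are presented as sliced diagrams: a diagram in general position with
respect to the height function is cut by horizontal lines into elementary slices, each containing
exactly one maximum, minimum or crossing. Two sliced diagrams represent isotopic links if and only
if they are related by planar isotopies of sliced diagrams and Reidemeister moves. -/

namespace LinkDiag

/-- The non-trivial part of an elementary slice, read upwards: a minimum `∪`, a maximum `∩`, or a
crossing. In `crossing true` the strand going from lower left to upper right is the overcrossing;
in `crossing false` it is the strand going from lower right to upper left. -/
inductive Kind
  | cup
  | cap
  | crossing (s : Bool)
  deriving DecidableEq

/-- Number of endpoints at the bottom. -/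
def Kind.bottom : Kind → ℕ
  | .cup => 0
  | .cap => 2
  | .crossing _ => 2

/-- Number of endpoints at the top. -/
def Kind.top : Kind → ℕ
  | .cup => 2
  | .cap => 0
  | .crossing _ => 2

/-- An elementary slice: an elementary tangle with `pos` vertical strands to its left, and any
number of vertical strands to its right. Positions of strands are counted from `0`. -/
structure Slice where
  pos : ℕ
  kind : Kind
  deriving DecidableEq

def cup (i : ℕ) : Slice := ⟨i, .cup⟩
def cap (i : ℕ) : Slice := ⟨i, .cap⟩
def cross (i : ℕ) (s : Bool) : Slice := ⟨i, .crossing s⟩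

/-- The number of strands at the top of a stack of slices (the head of the list is the lowest
slice) placed on `n` strands; `none` if the slices do not fit. -/
def width : List Slice → ℕ → Option ℕ
  | [], n => some n
  | s :: w, n =>
      if s.pos + s.kind.bottom ≤ n then width w (n - s.kind.bottom + s.kind.top) else none

/-- A link diagram: a stack of slices without endpoints at the bottom and at the top. -/
structure LinkDiagram where
  word : List Slice
  closed : width word 0 = some 0

/-! ### Moves -/

/-- Planar isotopies of sliced diagrams and Reidemeister moves, as local replacements. -/
inductive IsotopyRule : List Slice → List Slice → Prop
  /-- An elementary tangle `A` and an elementary tangle `B` to the right of it, separated by `d`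
  vertical strands, may exchange their heights. -/
  | exchange (A B : Kind) (i d : ℕ) :
      IsotopyRule [⟨i + A.bottom + d, B⟩, ⟨i, A⟩] [⟨i, A⟩, ⟨i + A.top + d, B⟩]
  /-- Cancellation of a minimum and a neighbouring maximum. -/
  | zigzag_left (i : ℕ) : IsotopyRule [cup i, cap (i + 1)] []
  | zigzag_right (i : ℕ) : IsotopyRule [cup (i + 1), cap i] []
  /-- A crossing slides over a maximum, or under a minimum. -/
  | slide_cap (i : ℕ) (s : Bool) :
      IsotopyRule [cross i s, cap (i + 1)] [cross (i + 1) (!s), cap i]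
  | slide_cup (i : ℕ) (s : Bool) :
      IsotopyRule [cup (i + 1), cross i s] [cup i, cross (i + 1) (!s)]
  /-- First Reidemeister move: a kink, drawn at a maximum or at a minimum, is removed. -/
  | reidemeister_one_cap (i : ℕ) (s : Bool) : IsotopyRule [cross i s, cap i] [cap i]
  | reidemeister_one_cup (i : ℕ) (s : Bool) : IsotopyRule [cup i, cross i s] [cup i]
  /-- Second Reidemeister move. -/
  | reidemeister_two (i : ℕ) (s : Bool) : IsotopyRule [cross i s, cross i (!s)] []
  /-- Third Reidemeister move; the condition says that the three strands lie at three different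
  heights. -/
  | reidemeister_three (i : ℕ) (s₁ s₂ s₃ : Bool) (h : s₂ = s₁ ∨ s₂ = s₃) :
      IsotopyRule [cross i s₁, cross (i + 1) s₂, cross i s₃]
        [cross (i + 1) s₃, cross i s₂, cross (i + 1) s₁]

/-- The local replacements generating `n`-move equivalence: isotopies, and the `n`-moves and
`(-n)`-moves, which insert `n` half twists into a pair of parallel strands. -/
inductive Rule (n : ℕ) : List Slice → List Slice → Prop
  | isotopy {l r : List Slice} (h : IsotopyRule l r) : Rule n l r
  | nMove (i : ℕ) (s : Bool) : Rule n (List.replicate n (cross i s)) []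

/-- `E` is obtained from `D` by one local replacement. -/
def Step (n : ℕ) (D E : LinkDiagram) : Prop :=
  ∃ u l r v : List Slice, Rule n l r ∧ D.word = u ++ l ++ v ∧ E.word = u ++ r ++ v

/-- `n`-move equivalence: the diagrams are related by a finite sequence of planar isotopies,
Reidemeister moves, `n`-moves, and inverses of these. -/
def MoveEquiv (n : ℕ) : LinkDiagram → LinkDiagram → Prop :=
  Relation.EqvGen (Step n)

/-! ### Trivial links and closed braids -/

theorem width_append (u v : List Slice) (n : ℕ) :
    width (u ++ v) n = (width u n).bind (width v) := by
  induction u generalizing n with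
  | nil => rfl
  | cons s u ih =>
    simp only [List.cons_append, width]
    split
    · exact ih _
    · rfl

/-- The trivial link diagram of `n` components: `n` circles without crossings. -/
def trivialLink (n : ℕ) : LinkDiagram where
  word := (List.replicate n [cup 0, cap 0]).flatten
  closed := by
    induction n with
    | zero => rfl
    | succ n ih =>
      rw [List.replicate_succ, List.flatten_cons, width_append]
      exact ih

/-- Braid words on `n` strands: `(i, true)` is the generator `σ_{i+1}` and `(i, false)` is its
inverse. -/
abbrev BraidWord (n : ℕ) := List (Fin (n - 1) × Bool)

def BraidWord.slices {n : ℕ} (b : BraidWord n) : List Slice :=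
  b.map fun x => cross x.1 x.2

/-- The `n` nested minima and maxima that close a braid on the first `n` of `2n` strands. -/
def closingCups (n : ℕ) : List Slice := (List.range n).map cup
def closingCaps (n : ℕ) : List Slice := (List.range n).reverse.map cap

theorem width_closingCups (n : ℕ) : width (closingCups n) 0 = some (2 * n) := by
  induction n with
  | zero => rfl
  | succ n ih =>
    rw [closingCups, List.range_succ, List.map_append, width_append]
    change (width (closingCups n) 0).bind _ = _
    rw [ih]
    simp [width, cup, Kind.bottom, Kind.top]
    omega

theorem width_closingCaps (n : ℕ) : width (closingCaps n) (2 * n) = some 0 := by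
  induction n with
  | zero => rfl
  | succ n ih =>
    rw [closingCaps, List.range_succ, List.reverse_append, List.map_append, width_append]
    have h : width (List.map cap [n].reverse) (2 * (n + 1)) = some (2 * n) := by
      simp [width, cap, Kind.bottom, Kind.top]
      omega
    rw [h]
    exact ih

theorem BraidWord.width_slices {n : ℕ} (b : BraidWord n) :
    width (BraidWord.slices b) (2 * n) = some (2 * n) := by
  induction b with
  | nil => rfl
  | cons x b ih =>
    have hx : (x.1 : ℕ) + 2 ≤ 2 * n := by have := x.1.isLt; omega
    have hn : 2 * n - 2 + 2 = 2 * n := by omega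
    have h : BraidWord.slices (n := n) (x :: b) = cross x.1 x.2 :: BraidWord.slices b := rfl
    rw [h]
    simpa [width, cross, Kind.bottom, Kind.top, hx, hn] using ih

/-- The closure of a braid. -/
def BraidWord.closure {n : ℕ} (b : BraidWord n) : LinkDiagram where
  word := closingCups n ++ b.slices ++ closingCaps n
  closed := by
    rw [width_append, width_append, width_closingCups, Option.bind_some, b.width_slices,
      Option.bind_some, width_closingCaps]

/-- The braid word `(σ₁⁻¹ σ₂ σ₃ σ₄⁻¹ σ₃)⁴`. -/
def chenBraid : BraidWord 5 :=
  (List.replicate 4 [(0, false), (1, true), (2, true), (3, false), (2, true)]).flatten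

/-- The braid word `Δ₅⁴ = (σ₁ σ₂ σ₃ σ₄)¹⁰`. -/
def deltaFourth : BraidWord 5 :=
  (List.replicate 10 [(0, true), (1, true), (2, true), (3, true)]).flatten

/-- Chen's link. -/
def chenLink : LinkDiagram := chenBraid.closure

/-! ### Burnside groups -/

/-- The quotient of `G` by all relations `a ^ n = 1`. -/
abbrev BurnsideQuotient (n : ℕ) (G : Type*) [Group G] : Type _ :=
  G ⧸ Subgroup.normalClosure (Set.range fun a : G => a ^ n)

/-- The Burnside group `B(r, n)`. -/
abbrev FreeBurnside (r n : ℕ) : Type := BurnsideQuotient n (FreeGroup (Fin r))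

/-- The standard generators of `B(r, n)`. -/
def FreeBurnside.gen (r n : ℕ) (i : Fin r) : FreeBurnside r n :=
  QuotientGroup.mk (FreeGroup.of i)

/-- The word `P = u w t u⁻¹ w⁻¹ t⁻¹` with `u = x y⁻¹ z t⁻¹` and `w = x⁻¹ y z⁻¹ t`. -/
def wordP {G : Type*} [Group G] (x y z t : G) : G :=
  let u := x * y⁻¹ * z * t⁻¹
  let w := x⁻¹ * y * z⁻¹ * t
  u * w * t * u⁻¹ * w⁻¹ * t⁻¹

/-- The element `P` of `B(4, 3) = {x, y, z, t : (a)³}`. -/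
def elementP : FreeBurnside 4 3 :=
  wordP (FreeBurnside.gen 4 3 0) (FreeBurnside.gen 4 3 1) (FreeBurnside.gen 4 3 2)
    (FreeBurnside.gen 4 3 3)

/-- The intersection points of a diagram with the horizontal lines between its slices. Each one
names the arc (from undercrossing to undercrossing) of the diagram on which it lies. -/
structure Strand (D : LinkDiagram) where
  level : ℕ
  pos : ℕ
  valid : ∃ n, width (D.word.take level) 0 = some n ∧ pos < n

/-- `Through s i j`: in the slice `s` the bottom endpoint number `i` and the top endpoint number
`j` lie on the same arc. -/
inductive Through : Slice → ℕ → ℕ → Prop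
  | left (s : Slice) (i : ℕ) (h : i < s.pos) : Through s i i
  | right (s : Slice) (d : ℕ) : Through s (s.pos + s.kind.bottom + d) (s.pos + s.kind.top + d)
  | over_true (i : ℕ) : Through (cross i true) i (i + 1)
  | over_false (i : ℕ) : Through (cross i false) (i + 1) i

open FreeGroup in
/-- The relators of the core group: strands on the same arc are identified, and each crossing
gives the relation `c = a b⁻¹ a`, where `a` is the overcrossing and `b`, `c` are the
undercrossings. -/
inductive CoreRelator (D : LinkDiagram) : FreeGroup (Strand D) → Prop
  | through (s : Slice) (p q : Strand D) (hs : D.word[p.level]? = some s)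
      (hq : q.level = p.level + 1) (h : Through s p.pos q.pos) :
      CoreRelator D (of p * (of q)⁻¹)
  | cup (i : ℕ) (p q : Strand D) (k : ℕ) (hs : D.word[k]? = some (LinkDiag.cup i))
      (hp : p.level = k + 1 ∧ p.pos = i) (hq : q.level = k + 1 ∧ q.pos = i + 1) :
      CoreRelator D (of p * (of q)⁻¹)
  | cap (i : ℕ) (p q : Strand D) (k : ℕ) (hs : D.word[k]? = some (LinkDiag.cap i))
      (hp : p.level = k ∧ p.pos = i) (hq : q.level = k ∧ q.pos = i + 1) :
      CoreRelator D (of p * (of q)⁻¹)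
  | crossing_true (i : ℕ) (a b c : Strand D) (k : ℕ) (hs : D.word[k]? = some (cross i true))
      (ha : a.level = k ∧ a.pos = i) (hb : b.level = k ∧ b.pos = i + 1)
      (hc : c.level = k + 1 ∧ c.pos = i) :
      CoreRelator D (of c * (of a * (of b)⁻¹ * of a)⁻¹)
  | crossing_false (i : ℕ) (a b c : Strand D) (k : ℕ) (hs : D.word[k]? = some (cross i false))
      (ha : a.level = k ∧ a.pos = i + 1) (hb : b.level = k ∧ b.pos = i)
      (hc : c.level = k + 1 ∧ c.pos = i + 1) :
      CoreRelator D (of c * (of a * (of b)⁻¹ * of a)⁻¹)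

/-- The core group of a diagram: arcs are generators, and each crossing gives a relation
`c = a b⁻¹ a`. -/
abbrev CoreGroup (D : LinkDiagram) : Type := PresentedGroup {r | CoreRelator D r}

/-- The class of an arc in the core group. -/
def arc {D : LinkDiagram} (e : Strand D) : CoreGroup D := PresentedGroup.of e

/-- The core presentation of the fundamental group of the double branched cover `M_D^(2)` of the
link: the core group with one arc `e` put equal to `1`. -/
abbrev DoubleCoverGroup (D : LinkDiagram) (e : Strand D) : Type :=
  CoreGroup D ⧸ Subgroup.normalClosure {arc e}

/-- The `n`th Burnside group, unreduced version: the core group modulo `n`th powers. -/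
abbrev CoreBurnside (n : ℕ) (D : LinkDiagram) : Type := BurnsideQuotient n (CoreGroup D)

/-- The `n`th Burnside group of a link: the fundamental group of the double branched cover modulo
`n`th powers. -/
abbrev LinkBurnside (n : ℕ) (D : LinkDiagram) (e : Strand D) : Type :=
  BurnsideQuotient n (DoubleCoverGroup D e)

end LinkDiag

namespace LinkDiag

/-! ### The braid group on five strands modulo cubes of the generators -/

section BraidIdentities

variable {G : Type*} [Group G] {a b c d : G}

/-- As a braid, `b a a b` carries the third strand around the first two, so it commutes with any
braiding of those two. `commute_twist_four` is the same for the fourth strand. -/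
theorem commute_twist_three (hab : a * b * a = b * a * b) : Commute (b * a * a * b) a := by
  calc b * a * a * b * a = b * a * (a * b * a) := by simp [mul_assoc]
    _ = (b * a * b) * a * b := by
      conv_lhs => rw [hab]
      simp [mul_assoc]
    _ = a * (b * a * a * b) := by
      conv_lhs => rw [← hab]
      simp [mul_assoc]

theorem commute_twist_four (hab : a * b * a = b * a * b) (hbc : b * c * b = c * b * c)
    (hac : a * c = c * a) :
    Commute (c * b * a * a * b * c) a ∧ Commute (c * b * a * a * b * c) b := by
  constructor
  · have h : Commute c a := hac.symm
    have := (h.mul_left (commute_twist_three hab)).mul_left h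
    simpa only [mul_assoc] using this
  · calc c * b * a * a * b * c * b = c * b * a * a * (b * c * b) := by simp [mul_assoc]
      _ = c * b * a * (a * c) * b * c := by
        conv_lhs => rw [hbc]
        simp [mul_assoc]
      _ = c * b * (a * c) * a * b * c := by
        conv_lhs => rw [hac]
        simp [mul_assoc]
      _ = (c * b * c) * a * a * b * c := by
        conv_lhs => rw [hac]
        simp [mul_assoc]
      _ = b * (c * b * a * a * b * c) := by
        conv_lhs => rw [← hbc]
        simp [mul_assoc]

/-- A full twist is the full twist of all strands but the last, times the loop of the last strand
around them. -/
theorem full_twist_three (hab : a * b * a = b * a * b) :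
    (a * b) ^ 3 = a * a * (b * a * a * b) := by
  calc (a * b) ^ 3 = (a * b * a) * (b * a * b) := by simp [pow_succ, mul_assoc]
    _ = a * b * a * (a * b * a) := by
      conv_lhs => rw [← hab]
    _ = a * (b * a * a * b) * a := by simp [mul_assoc]
    _ = a * ((b * a * a * b) * a) := by simp [mul_assoc]
    _ = a * a * (b * a * a * b) := by
      conv_lhs => rw [(commute_twist_three hab).eq]
      simp [mul_assoc]

theorem commute_full_twist_three (hab : a * b * a = b * a * b) :
    Commute ((a * b) ^ 3) a ∧ Commute ((a * b) ^ 3) b := by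
  have h1 : Commute ((a * b) ^ 3) a := by
    rw [full_twist_three hab]
    exact ((Commute.refl a).mul_left (Commute.refl a)).mul_left (commute_twist_three hab)
  refine ⟨h1, ?_⟩
  have h2 : Commute ((a * b) ^ 3) (a⁻¹ * (a * b)) :=
    h1.inv_right.mul_right ((Commute.refl (a * b)).pow_left 3)
  simpa using h2

theorem full_twist_three_symm (hab : a * b * a = b * a * b) : (b * a) ^ 3 = (a * b) ^ 3 := by
  have h := (commute_full_twist_three hab).2
  calc (b * a) ^ 3 = b * (a * b) ^ 3 * b⁻¹ := by simp [pow_succ, mul_assoc]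
    _ = (a * b) ^ 3 := by rw [← h.eq, mul_inv_cancel_right]

theorem full_twist_four (hab : a * b * a = b * a * b) (hbc : b * c * b = c * b * c)
    (hac : a * c = c * a) :
    (a * b * c) ^ 4 = (a * b) ^ 3 * (c * b * a * a * b * c) := by
  have h2 : (a * b * c) ^ 2 = (a * b) ^ 2 * (c * b) := by
    calc (a * b * c) ^ 2 = a * b * (c * a) * b * c := by simp [pow_succ, mul_assoc]
      _ = a * b * a * (c * b * c) := by
        conv_lhs => rw [← hac]
        simp [mul_assoc]
      _ = (a * b) ^ 2 * (c * b) := by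
        conv_lhs => rw [← hbc]
        simp [pow_succ, mul_assoc]
  have h3 : (a * b * c) ^ 3 = (a * b) ^ 3 * (c * b * a) := by
    calc (a * b * c) ^ 3 = (a * b * c) ^ 2 * (a * b * c) := by simp [pow_succ, mul_assoc]
      _ = (a * b) ^ 2 * c * (b * a * b) * c := by
        conv_lhs => rw [h2]
        simp [pow_succ, mul_assoc]
      _ = (a * b) ^ 2 * (c * a) * b * (a * c) := by
        conv_lhs => rw [← hab]
        simp [pow_succ, mul_assoc]
      _ = (a * b) ^ 2 * a * c * b * (a * c) := by
        conv_lhs => rw [← hac]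
        simp [pow_succ, mul_assoc]
      _ = (a * b) ^ 2 * a * (c * b * c) * a := by
        conv_lhs => rw [hac]
        simp [pow_succ, mul_assoc]
      _ = (a * b) ^ 3 * (c * b * a) := by
        conv_lhs => rw [← hbc]
        simp [pow_succ, mul_assoc]
  calc (a * b * c) ^ 4 = (a * b * c) ^ 3 * (a * b * c) := by simp [pow_succ, mul_assoc]
    _ = (a * b) ^ 3 * (c * b * a * a * b * c) := by
      conv_lhs => rw [h3]
      simp [pow_succ, mul_assoc]

theorem commute_full_twist_four (hab : a * b * a = b * a * b) (hbc : b * c * b = c * b * c)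
    (hac : a * c = c * a) : Commute ((a * b * c) ^ 4) c := by
  have hb : Commute ((a * b * c) ^ 4) b := by
    rw [full_twist_four hab hbc hac]
    exact (commute_full_twist_three hab).2.mul_left (commute_twist_four hab hbc hac).2
  -- Conjugation by `a b c` shifts `b` to `c`, and `a b c` commutes with its own powers. So
  -- commutation with `b` yields commutation with `c`.
  have hc : (a * b * c) * b * (a * b * c)⁻¹ = c := by
    rw [mul_inv_eq_iff_eq_mul]
    symm
    calc c * (a * b * c) = (c * a) * b * c := by simp [mul_assoc]
      _ = a * (c * b * c) := by
        conv_lhs => rw [← hac]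
        simp [mul_assoc]
      _ = a * b * c * b := by
        conv_lhs => rw [← hbc]
        simp [mul_assoc]
  have hd := (Commute.refl (a * b * c)).pow_left 4
  have := (hd.mul_right hb).mul_right hd.inv_right
  rwa [hc] at this

/-- The last strand is pulled out one factor at a time: `(a b c d)^k` is `(a b c)^k` times the first
`k` letters of `d c b a`, for `k = 2, 3, 4`. The fifth factor completes the loop of the last strand.
-/
theorem full_twist_five (hab : a * b * a = b * a * b) (hbc : b * c * b = c * b * c)
    (hcd : c * d * c = d * c * d) (hac : a * c = c * a) (had : a * d = d * a)
    (hbd : b * d = d * b) :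
    (a * b * c * d) ^ 5 = (a * b * c) ^ 4 * (d * c * b * a * a * b * c * d) := by
  have h2 : (a * b * c * d) ^ 2 = (a * b * c) ^ 2 * (d * c) := by
    calc (a * b * c * d) ^ 2 = a * b * c * (d * a) * b * c * d := by simp [pow_succ, mul_assoc]
      _ = a * b * c * a * (d * b) * c * d := by
        conv_lhs => rw [← had]
        simp [mul_assoc]
      _ = a * b * c * a * b * (d * c * d) := by
        conv_lhs => rw [← hbd]
        simp [mul_assoc]
      _ = (a * b * c) ^ 2 * (d * c) := by
        conv_lhs => rw [← hcd]
        simp [pow_succ, mul_assoc]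
  have h3 : (a * b * c * d) ^ 3 = (a * b * c) ^ 3 * (d * c * b) := by
    calc (a * b * c * d) ^ 3 = (a * b * c * d) ^ 2 * (a * b * c * d) := by
          simp [pow_succ, mul_assoc]
      _ = (a * b * c) ^ 2 * d * (c * a) * b * c * d := by
        conv_lhs => rw [h2]
        simp [pow_succ, mul_assoc]
      _ = (a * b * c) ^ 2 * (d * a) * (c * b * c) * d := by
        conv_lhs => rw [← hac]
        simp [pow_succ, mul_assoc]
      _ = (a * b * c) ^ 2 * a * (d * b) * c * (b * d) := by
        conv_lhs => rw [← had, ← hbc]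
        simp [pow_succ, mul_assoc]
      _ = (a * b * c) ^ 2 * a * b * d * c * (b * d) := by
        conv_lhs => rw [← hbd]
        simp [pow_succ, mul_assoc]
      _ = (a * b * c) ^ 2 * a * b * (d * c * d) * b := by
        conv_lhs => rw [hbd]
        simp [pow_succ, mul_assoc]
      _ = (a * b * c) ^ 3 * (d * c * b) := by
        conv_lhs => rw [← hcd]
        simp [pow_succ, mul_assoc]
  have h4 : (a * b * c * d) ^ 4 = (a * b * c) ^ 4 * (d * c * b * a) := by
    calc (a * b * c * d) ^ 4 = (a * b * c * d) ^ 3 * (a * b * c * d) := by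
          simp [pow_succ, mul_assoc]
      _ = (a * b * c) ^ 3 * d * c * (b * a * b) * c * d := by
        conv_lhs => rw [h3]
        simp [pow_succ, mul_assoc]
      _ = (a * b * c) ^ 3 * d * (c * a) * b * (a * c) * d := by
        conv_lhs => rw [← hab]
        simp [pow_succ, mul_assoc]
      _ = (a * b * c) ^ 3 * d * a * c * b * (a * c) * d := by
        conv_lhs => rw [← hac]
        simp [pow_succ, mul_assoc]
      _ = (a * b * c) ^ 3 * (d * a) * (c * b * c) * (a * d) := by
        conv_lhs => rw [hac]
        simp [pow_succ, mul_assoc]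
      _ = (a * b * c) ^ 3 * a * d * (b * c * b) * (a * d) := by
        conv_lhs => rw [← had, ← hbc]
        simp [pow_succ, mul_assoc]
      _ = (a * b * c) ^ 3 * a * (d * b) * c * b * d * a := by
        conv_lhs => rw [had]
        simp [pow_succ, mul_assoc]
      _ = (a * b * c) ^ 3 * a * b * d * c * (b * d) * a := by
        conv_lhs => rw [← hbd]
        simp [pow_succ, mul_assoc]
      _ = (a * b * c) ^ 3 * a * b * (d * c * d) * b * a := by
        conv_lhs => rw [hbd]
        simp [pow_succ, mul_assoc]
      _ = (a * b * c) ^ 4 * (d * c * b * a) := by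
        conv_lhs => rw [← hcd]
        simp [pow_succ, mul_assoc]
  calc (a * b * c * d) ^ 5 = (a * b * c * d) ^ 4 * (a * b * c * d) := by simp [pow_succ, mul_assoc]
    _ = (a * b * c) ^ 4 * (d * c * b * a * a * b * c * d) := by
      conv_lhs => rw [h4]
      simp [pow_succ, mul_assoc]

/-! ### Consequences of the cubic relations -/

theorem mul_self_eq_inv (ha : a ^ 3 = 1) : a * a = a⁻¹ :=
  eq_inv_of_mul_eq_one_left (by rw [← ha]; simp [pow_succ])

/-- Since `a² = a⁻¹`, the loop `b a a b` is `b a⁻¹ b`, and `full_twist_three` expresses it by the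
full twist. -/
theorem mul_inv_mul_eq_twist (ha : a ^ 3 = 1) (hab : a * b * a = b * a * b) :
    b * a⁻¹ * b = (a * b) ^ 3 * a := by
  have h := commute_twist_three hab
  symm
  calc (a * b) ^ 3 * a = a * a * ((b * a * a * b) * a) := by
        conv_lhs => rw [full_twist_three hab]
        simp [mul_assoc]
    _ = a ^ 3 * (b * (a * a) * b) := by
      conv_lhs => rw [h.eq]
      simp [pow_succ, mul_assoc]
    _ = b * a⁻¹ * b := by
      conv_lhs => rw [ha, mul_self_eq_inv ha]
      simp [mul_assoc]

/-- The braid group on three strands modulo cubes of the generators is `SL(2, 𝔽₃)`, where the full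
twist is `-1`. The proof is a direct computation from the two expressions of the full twist in `a⁻¹`
and `b`. -/
theorem full_twist_three_sq (ha : a ^ 3 = 1) (hb : b ^ 3 = 1) (hab : a * b * a = b * a * b) :
    (a * b) ^ 3 * (a * b) ^ 3 = 1 := by
  have hz : (a * b) ^ 3 = b * a⁻¹ * b * a⁻¹ := by rw [mul_inv_mul_eq_twist ha hab]; simp
  have hz' : (a * b) ^ 3 = a⁻¹ * (b * a⁻¹ * b) := by
    rw [mul_inv_mul_eq_twist ha hab, (commute_full_twist_three hab).1.eq]; simp
  have h1 : a⁻¹ * b⁻¹ * a⁻¹ = b⁻¹ * a⁻¹ * b⁻¹ := by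
    have := congrArg (·⁻¹) hab
    simpa only [mul_inv_rev, mul_assoc] using this
  calc (a * b) ^ 3 * (a * b) ^ 3 = a⁻¹ * (b * a⁻¹ * b) * (b * a⁻¹ * b * a⁻¹) := by
        nth_rw 1 [hz']; rw [hz]
    _ = a⁻¹ * b * a⁻¹ * (b * b) * a⁻¹ * b * a⁻¹ := by simp [mul_assoc]
    _ = a⁻¹ * b * (a⁻¹ * b⁻¹ * a⁻¹) * b * a⁻¹ := by
      rw [mul_self_eq_inv hb]; simp [mul_assoc]
    _ = a⁻¹ * (a * a)⁻¹ := by rw [h1]; simp [mul_assoc]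
    _ = 1 := by rw [mul_self_eq_inv ha]; simp

/-- Conjugating `c` by the full twist of `a` and `b` gives an element commuting with `a` and `c`;
the product of the three commutes with `b`. -/
theorem commute_conj_twist (ha : a ^ 3 = 1) (hab : a * b * a = b * a * b)
    (hbc : b * c * b = c * b * c) (hac : a * c = c * a) :
    Commute ((a * b) ^ 3 * c * (a * b) ^ 3) a ∧ Commute ((a * b) ^ 3 * c * (a * b) ^ 3) c ∧
      Commute ((a * b) ^ 3 * c * (a * b) ^ 3 * c * a) b := by
  have hz := commute_full_twist_three hab
  have h1 : Commute ((a * b) ^ 3 * c * (a * b) ^ 3) a :=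
    (hz.1.mul_left (show Commute c a from hac.symm)).mul_left hz.1
  -- The product is the full twist on four strands, which commutes with `a`, `b` and `c`; all three
  -- claims follow from this.
  have hX : (a * b) ^ 3 * c * (a * b) ^ 3 * c * a = (a * b * c) ^ 4 := by
    rw [full_twist_four hab hbc hac]
    calc (a * b) ^ 3 * c * (a * b) ^ 3 * c * a = (a * b) ^ 3 * c * (a * b) ^ 3 * (a * c) := by
          rw [hac, ← mul_assoc]
      _ = (a * b) ^ 3 * c * ((a * b) ^ 3 * a) * c := by simp only [mul_assoc]
      _ = (a * b) ^ 3 * (c * b * a * a * b * c) := by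
        rw [← mul_inv_mul_eq_twist ha hab, ← mul_self_eq_inv ha]; simp only [mul_assoc]
  refine ⟨h1, ?_, ?_⟩
  · have h2 : Commute ((a * b) ^ 3 * c * (a * b) ^ 3 * c * a) c := by
      rw [hX]; exact commute_full_twist_four hab hbc hac
    have h3 := (h2.mul_left (show Commute a c from hac).inv_left).mul_left
      (Commute.refl c).inv_left
    simpa using h3
  · rw [hX, full_twist_four hab hbc hac]
    exact hz.2.mul_left (commute_twist_four hab hbc hac).2

/-- Write `ζ = (a b)³` and `m = ζ c ζ`. The heart is `a b a (c b)³ b a b = m c⁻¹`; the rest uses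
only `c m = m c` and `c³ = 1`. In `chenBraid_identity` it is applied to `c`, `d` and the conjugate
of `c` by the full twist of `a` and `b`. -/
theorem conj_twist_identity (ha : a ^ 3 = 1) (hb : b ^ 3 = 1) (hc : c ^ 3 = 1)
    (hab : a * b * a = b * a * b) (hbc : b * c * b = c * b * c) (hac : a * c = c * a) :
    a * c⁻¹ * a * b * a * (c * b) ^ 3 * b * a * b = a * c * ((a * b) ^ 3 * c * (a * b) ^ 3) := by
  obtain ⟨hma, hmc, hmb⟩ := commute_conj_twist ha hab hbc hac
  have hz := commute_full_twist_three hab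
  have hzz := full_twist_three_sq ha hb hab
  have hcb := mul_inv_mul_eq_twist hb hab.symm
  rw [full_twist_three_symm hab] at hcb
  have hcb' : (c * b) ^ 3 = c * b⁻¹ * c * b⁻¹ := by
    rw [mul_inv_mul_eq_twist hb hbc, full_twist_three_symm hbc, mul_inv_cancel_right]
  have hbA := mul_inv_mul_eq_twist ha hab
  generalize hζ : (a * b) ^ 3 = ζ at *
  have hm : ζ * (ζ * c * ζ) = c * ζ := by rw [← mul_assoc, ← mul_assoc, hzz, one_mul]
  generalize hM : ζ * c * ζ = m at *
  have key : a * b * a * (c * b) ^ 3 * (b * a * b) = m * c⁻¹ := by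
    calc a * b * a * (c * b) ^ 3 * (b * a * b) = a * b * (a * c) * b⁻¹ * (c * a) * b := by
          conv_lhs => rw [hcb']
          simp [mul_assoc]
      _ = a * b * c * a * b⁻¹ * (c * a) * b := by
        conv_lhs => rw [hac]
        simp [mul_assoc]
      _ = a * b * c * (a * b⁻¹ * a) * c * b := by
        conv_lhs => rw [← hac]
        simp [mul_assoc]
      _ = a * b * c * ζ * (b * c * b) := by
        conv_lhs => rw [hcb]
        simp [mul_assoc]
      -- The factor `1` is there to become `ζ ζ`, which completes `c ζ` to `m = ζ c ζ`.
      _ = a * b * 1 * c * ζ * c * b * c := by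
        conv_lhs => rw [hbc]
        simp [mul_assoc]
      _ = a * (b * ζ) * (ζ * c * ζ) * c * b * c := by
        conv_lhs => rw [← hzz]
        simp [mul_assoc]
      _ = (a * ζ) * b * m * c * b * c := by
        conv_lhs => rw [hM, ← hz.2.eq]
        simp [mul_assoc]
      -- Inserting `a a⁻¹` produces `m c a`, the full twist on four strands, past which `b` can be
      -- moved.
      _ = ζ * a * b * (m * c * a) * a⁻¹ * b * c := by
        conv_lhs => rw [← hz.1.eq]
        simp [mul_assoc]
      _ = ζ * a * (b * (m * c * a)) * a⁻¹ * b * c := by simp [mul_assoc]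
      _ = ζ * (a * m) * c * a * (b * a⁻¹ * b) * c := by
        conv_lhs => rw [← hmb.eq]
        simp [mul_assoc]
      _ = ζ * m * (a * c) * a * ζ * (a * c) := by
        conv_lhs => rw [← hma.eq, hbA]
        simp [mul_assoc]
      _ = ζ * m * c * (a * a) * ζ * (c * a) := by
        conv_lhs => rw [hac]
        simp [mul_assoc]
      _ = ζ * m * c * a⁻¹ * ζ * (a * c) := by
        conv_lhs => rw [mul_self_eq_inv ha, ← hac]
      _ = ζ * m * c * a⁻¹ * (ζ * a) * c := by simp [mul_assoc]
      _ = ζ * m * c * ζ * c := by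
        conv_lhs => rw [hz.1.eq]
        simp [mul_assoc]
      _ = (ζ * m) * c * ζ * c := by simp [mul_assoc]
      _ = c * (ζ * c * ζ) * c := by
        conv_lhs => rw [hm]
        simp [mul_assoc]
      _ = c * m * c := by
        conv_lhs => rw [hM]
      _ = m * (c * c) := by
        conv_lhs => rw [← hmc.eq]
        simp [mul_assoc]
      _ = m * c⁻¹ := by
        conv_lhs => rw [mul_self_eq_inv hc]
  calc a * c⁻¹ * a * b * a * (c * b) ^ 3 * b * a * b
      = a * c⁻¹ * (a * b * a * (c * b) ^ 3 * (b * a * b)) := by simp only [mul_assoc]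
    _ = a * (c⁻¹ * m) * c⁻¹ := by rw [key]; simp only [mul_assoc]
    _ = a * m * (c * c)⁻¹ := by rw [← hmc.inv_right.eq]; simp only [mul_assoc, mul_inv_rev]
    _ = a * c * m := by rw [mul_self_eq_inv hc, inv_inv, mul_assoc, hmc.eq, mul_assoc]



/-- Put `ζ = (a b)³`, `ω = (c d)³`, `k = ζ c ζ` and `m = ω k ω`; both sides are shown to equal `a c
k m`. On the left, conjugation by `b c` gives `b a⁻¹ b c d⁻¹ = a ζ c d⁻¹`, and two squarings, in
which `a` splits off, reach `a c k m`. On the right, the square of the full twist loses its factor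
`ζ² = 1`, and `conj_twist_identity` evaluates the squares of the two remaining loops. The
conjugation is harmless because the full twist commutes with `b` and `c`. -/
theorem chenBraid_identity (ha : a ^ 3 = 1) (hb : b ^ 3 = 1) (hc : c ^ 3 = 1) (hd : d ^ 3 = 1)
    (hab : a * b * a = b * a * b) (hbc : b * c * b = c * b * c)
    (hcd : c * d * c = d * c * d) (hac : a * c = c * a) (had : a * d = d * a)
    (hbd : b * d = d * b) :
    (a⁻¹ * b * c * d⁻¹ * c) ^ 4 = (a * b * c * d) ^ 10 := by
  have hbeta : (b * c) * (a⁻¹ * b * c * d⁻¹ * c) * (b * c)⁻¹ = b * a⁻¹ * b * (c * d⁻¹) := by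
    have hca : c * a⁻¹ = a⁻¹ * c := (show Commute c a from hac.symm).inv_right.eq
    have hdb : b * d⁻¹ = d⁻¹ * b := (show Commute b d from hbd).inv_right.eq
    calc (b * c) * (a⁻¹ * b * c * d⁻¹ * c) * (b * c)⁻¹ = b * (c * a⁻¹) * b * c * d⁻¹ * b⁻¹ := by
          simp [mul_assoc]
      _ = b * a⁻¹ * (c * b * c) * d⁻¹ * b⁻¹ := by rw [hca]; simp only [mul_assoc]
      _ = b * a⁻¹ * b * c * (b * d⁻¹) * b⁻¹ := by rw [← hbc]; simp only [mul_assoc]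
      _ = b * a⁻¹ * b * (c * d⁻¹) := by rw [hdb]; simp [mul_assoc]
  -- the full twist commutes with `b` and `c`, so it suffices to treat a conjugate
  have hX := commute_twist_four hab hbc hac
  have hY : d * c * b * a * a * b * c * d = d * (c * b * a * a * b * c) * d := by
    simp only [mul_assoc]
  have hYa : Commute (d * c * b * a * a * b * c * d) a := by
    rw [hY]
    exact ((show Commute d a from had.symm).mul_left hX.1).mul_left had.symm
  have hYb : Commute (d * c * b * a * a * b * c * d) b := by
    rw [hY]
    exact ((show Commute d b from hbd.symm).mul_left hX.2).mul_left hbd.symm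
  have hYc : Commute (d * c * b * a * a * b * c * d) c := by
    have hbd' : Commute d b := hbd.symm
    have had' : Commute d a := had.symm
    have hW : Commute d (b * a * a * b) :=
      ((hbd'.mul_right had').mul_right had').mul_right hbd'
    calc d * c * b * a * a * b * c * d * c = d * c * (b * a * a * b) * (c * d * c) := by
          simp only [mul_assoc]
      _ = d * c * ((b * a * a * b) * d) * c * d := by rw [hcd]; simp only [mul_assoc]
      _ = (d * c * d) * (b * a * a * b) * c * d := by rw [← hW.eq]; simp only [mul_assoc]
      _ = c * (d * c * b * a * a * b * c * d) := by rw [← hcd]; simp only [mul_assoc]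
  have hz := commute_full_twist_three hab
  have hZ := commute_full_twist_four hab hbc hac
  have hfive := full_twist_five hab hbc hcd hac had hbd
  have hfour := full_twist_four hab hbc hac
  have hZb : Commute ((a * b * c) ^ 4) b := by
    rw [hfour]; exact hz.2.mul_left hX.2
  have hten : (a * b * c * d) ^ 10 = ((a * b * c * d) ^ 5) ^ 2 := by rw [← pow_mul]
  have hcomm : Commute ((a * b * c * d) ^ 10) (b * c) := by
    rw [hten, hfive]
    exact Commute.pow_left ((hZb.mul_left hYb).mul_right (hZ.mul_left hYc)) 2
  -- the elements that appear in the computation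
  have hzz := full_twist_three_sq ha hb hab
  have hww := full_twist_three_sq hc hd hcd
  have hz_c := mul_inv_mul_eq_twist ha hab
  have hw_d := mul_inv_mul_eq_twist hc hcd
  have hw_c := mul_inv_mul_eq_twist hd hcd.symm
  rw [full_twist_three_symm hcd] at hw_c
  have hw := commute_full_twist_three hcd
  obtain ⟨hka, hkc, -⟩ := commute_conj_twist ha hab hbc hac
  have hzd : Commute ((a * b) ^ 3) d :=
    ((show Commute a d from had).mul_left hbd).pow_left 3
  -- The full twist is the product of three commuting factors: `(a b)³` and the loops of the fourth
  -- and fifth strands. The first has square `1`.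
  have hten' : (a * b * c * d) ^ 10 = (c * b * a * a * b * c) * (c * b * a * a * b * c) *
      ((d * c * b * a * a * b * c * d) * (d * c * b * a * a * b * c * d)) := by
    have hZY : Commute ((a * b * c) ^ 4) (d * c * b * a * a * b * c * d) :=
      (((hYa.mul_right hYb).mul_right hYc).pow_right 4).symm
    have hzX : Commute ((a * b) ^ 3) (c * b * a * a * b * c) :=
      ((hX.1.mul_right hX.2).pow_right 3).symm
    rw [hten, hfive, hZY.mul_pow, hfour, hzX.mul_pow, pow_two ((a * b) ^ 3), hzz, one_mul,
      pow_two, pow_two]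
  have hXe : c * b * a * a * b * c = c * (a * b) ^ 3 * c * a := by
    calc c * b * a * a * b * c = c * (b * (a * a) * b) * c := by simp only [mul_assoc]
      _ = c * (a * b) ^ 3 * (a * c) := by
        rw [mul_self_eq_inv ha, hz_c]; simp only [mul_assoc]
      _ = c * (a * b) ^ 3 * c * a := by rw [hac]; simp only [mul_assoc]
  have hYe : d * c * b * a * a * b * c * d = d * c * (a * b) ^ 3 * c * d * a := by
    calc d * c * b * a * a * b * c * d = d * (c * b * a * a * b * c) * d := hY
      _ = d * c * (a * b) ^ 3 * c * (a * d) := by rw [hXe]; simp only [mul_assoc]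
      _ = d * c * (a * b) ^ 3 * c * d * a := by rw [had]; simp only [mul_assoc]
  -- Conjugation by the involution `(a b)³` fixes `d`, so the conjugate of `c` inherits from `c` its
  -- order and its braid relation with `d`. It also commutes with `c`, so `c`, `d` and it satisfy
  -- the relations required of `a`, `b`, `c` in `conj_twist_identity`.
  have hk3 : ((a * b) ^ 3 * c * (a * b) ^ 3) ^ 3 = 1 := by
    have hi : (a * b) ^ 3 = ((a * b) ^ 3)⁻¹ := eq_inv_of_mul_eq_one_left hzz
    nth_rw 2 [hi]
    rw [conj_pow, hc, mul_one, mul_inv_cancel]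
  have hkd : d * ((a * b) ^ 3 * c * (a * b) ^ 3) * d =
      ((a * b) ^ 3 * c * (a * b) ^ 3) * d * ((a * b) ^ 3 * c * (a * b) ^ 3) := by
    have h1 : d * ((a * b) ^ 3 * c * (a * b) ^ 3) * d =
        (a * b) ^ 3 * (d * c * d) * (a * b) ^ 3 := by
      calc d * ((a * b) ^ 3 * c * (a * b) ^ 3) * d
          = (d * (a * b) ^ 3) * c * ((a * b) ^ 3 * d) := by simp only [mul_assoc]
        _ = (a * b) ^ 3 * (d * c * d) * (a * b) ^ 3 := by
          rw [← hzd.eq]; nth_rw 2 [hzd.eq]; simp only [mul_assoc]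
    rw [h1, ← hcd]
    symm
    calc (a * b) ^ 3 * c * (a * b) ^ 3 * d * ((a * b) ^ 3 * c * (a * b) ^ 3)
        = (a * b) ^ 3 * c * ((a * b) ^ 3 * d) * ((a * b) ^ 3) * c * (a * b) ^ 3 := by
          simp only [mul_assoc]
      _ = (a * b) ^ 3 * c * d * ((a * b) ^ 3 * (a * b) ^ 3) * c * (a * b) ^ 3 := by
        rw [hzd.eq]; simp only [mul_assoc]
      _ = (a * b) ^ 3 * (c * d * c) * (a * b) ^ 3 := by rw [hzz]; simp [mul_assoc]
  have hid := conj_twist_identity hc hd hk3 hcd hkd hkc.symm.eq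
  obtain ⟨hmc, hmk, -⟩ := commute_conj_twist hc hcd hkd hkc.symm.eq
  have hkd3 : ((a * b) ^ 3 * c * (a * b) ^ 3 * d) ^ 3 =
      (a * b) ^ 3 * (c * d) ^ 3 * (a * b) ^ 3 := by
    have hi : (a * b) ^ 3 = ((a * b) ^ 3)⁻¹ := eq_inv_of_mul_eq_one_left hzz
    have h1 : (a * b) ^ 3 * c * (a * b) ^ 3 * d = (a * b) ^ 3 * (c * d) * ((a * b) ^ 3)⁻¹ := by
      rw [← hi, mul_assoc _ _ d, hzd.eq]; simp only [mul_assoc]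
    rw [h1, conj_pow, ← hi]
  generalize hK : (a * b) ^ 3 * c * (a * b) ^ 3 = k at *
  generalize hM : (c * d) ^ 3 * k * (c * d) ^ 3 = m at *
  generalize hζ : (a * b) ^ 3 = ζ at *
  generalize hω : (c * d) ^ 3 = ω at *
  have hac' : Commute a c := hac
  have had' : Commute a d := had
  have hleft : (b * a⁻¹ * b * (c * d⁻¹)) ^ 4 = a * (c * k * m) := by
    have h1 : d⁻¹ * c * d⁻¹ = ω * c⁻¹ := by
      have h2 := congrArg (·⁻¹) hw_d
      have h3 : ω⁻¹ = ω := inv_eq_of_mul_eq_one_left hww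
      simp only [mul_inv_rev, inv_inv, h3, ← mul_assoc] at h2
      rw [h2, hw.1.inv_right.eq]
    have h2 : (b * a⁻¹ * b * (c * d⁻¹)) ^ 2 = a⁻¹ * (k * ω * c⁻¹) := by
      have hc2 : Commute a (ζ * c * d⁻¹) :=
        (hz.1.symm.mul_right hac').mul_right had'.inv_right
      calc (b * a⁻¹ * b * (c * d⁻¹)) ^ 2 = (a * (ζ * c * d⁻¹)) ^ 2 := by
            rw [hz_c, hz.1.eq]; simp only [mul_assoc]
        _ = a * a * (ζ * c * (d⁻¹ * ζ) * c * d⁻¹) := by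
          rw [hc2.mul_pow, pow_two, pow_two]; simp only [mul_assoc]
        _ = a⁻¹ * ((ζ * c * ζ) * (d⁻¹ * c * d⁻¹)) := by
          rw [mul_self_eq_inv ha, ← hzd.inv_right.eq]; simp only [mul_assoc]
        _ = a⁻¹ * (k * ω * c⁻¹) := by rw [hK, h1]; simp only [mul_assoc]
    have haω : Commute a ω := by
      rw [← hω]; exact (hac'.mul_right had').pow_right 3
    have hc3 : Commute a⁻¹ (k * ω * c⁻¹) :=
      ((hka.symm.mul_right haω).mul_right hac'.inv_right).inv_left
    calc (b * a⁻¹ * b * (c * d⁻¹)) ^ 4 = ((b * a⁻¹ * b * (c * d⁻¹)) ^ 2) ^ 2 := by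
          rw [← pow_mul]
      _ = (a * a)⁻¹ * (k * (ω * c⁻¹) * k * ω * c⁻¹) := by
        rw [h2, hc3.mul_pow, pow_two, pow_two]; simp only [mul_assoc, mul_inv_rev]
      _ = a * (k * c⁻¹ * (ω * k * ω) * c⁻¹) := by
        rw [mul_self_eq_inv ha, inv_inv, hw.1.inv_right.eq]; simp only [mul_assoc]
      _ = a * (k * (c * c)⁻¹ * m) := by
        rw [hM, mul_assoc _ m, hmc.inv_right.eq]; simp only [mul_assoc, mul_inv_rev]
      _ = a * (c * k * m) := by rw [mul_self_eq_inv hc, inv_inv, hkc.eq]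
  have hright : (a * b * c * d) ^ 10 = a * (c * k * m) := by
    have hk' : k⁻¹ = ζ * c⁻¹ * ζ := by
      have h3 : ζ⁻¹ = ζ := inv_eq_of_mul_eq_one_left hzz
      rw [← hK]; simp only [mul_inv_rev, h3, mul_assoc]
    have hXX : c * ζ * c * a * (c * ζ * c * a) = a⁻¹ * (c * k⁻¹ * c) := by
      have h4 : Commute (c * ζ * c) a := (hac'.symm.mul_left hz.1).mul_left hac'.symm
      calc c * ζ * c * a * (c * ζ * c * a) = (c * ζ * c * a) ^ 2 := by rw [pow_two]
        _ = (a * a) * (c * ζ * (c * c) * ζ * c) := by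
          rw [h4.eq, h4.symm.mul_pow, pow_two, pow_two]; simp only [mul_assoc]
        _ = a⁻¹ * (c * k⁻¹ * c) := by
          rw [mul_self_eq_inv ha, mul_self_eq_inv hc, hk']; simp only [mul_assoc]
    have hYY : d * c * ζ * c * d * a * (d * c * ζ * c * d * a) =
        a⁻¹ * (d * c * (k * d) ^ 3 * d * c * d) := by
      have h4 : Commute (d * c * ζ * c * d) a :=
        ((((had'.symm.mul_left hac'.symm)).mul_left hz.1).mul_left hac'.symm).mul_left had'.symm
      calc d * c * ζ * c * d * a * (d * c * ζ * c * d * a) = (d * c * ζ * c * d * a) ^ 2 := by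
            rw [pow_two]
        _ = (a * a) * (d * c * ζ * (c * (d * d) * c) * ζ * c * d) := by
          rw [h4.eq, h4.symm.mul_pow, pow_two, pow_two]; simp only [mul_assoc]
        _ = a⁻¹ * (d * c * ζ * ω * (d * ζ) * c * d) := by
          rw [mul_self_eq_inv ha, mul_self_eq_inv hd, hw_c]; simp only [mul_assoc]
        _ = a⁻¹ * (d * c * (k * d) ^ 3 * d * c * d) := by
          rw [← hzd.eq, hkd3]; simp only [mul_assoc]
    have h5 : Commute (c * k⁻¹ * c) a⁻¹ :=
      ((hac'.symm.mul_left hka.inv_left).mul_left hac'.symm).inv_right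
    calc (a * b * c * d) ^ 10 = a⁻¹ * ((c * k⁻¹ * c) * a⁻¹) *
          (d * c * (k * d) ^ 3 * d * c * d) := by
          rw [hten', hXe, hYe, hXX, hYY]; simp only [mul_assoc]
      _ = (a * a)⁻¹ * (c * k⁻¹ * c * d * c * (k * d) ^ 3 * d * c * d) := by
        rw [h5.eq]; simp only [mul_assoc, mul_inv_rev]
      _ = a * (c * k * m) := by rw [mul_self_eq_inv ha, inv_inv, hid]
  calc (a⁻¹ * b * c * d⁻¹ * c) ^ 4
      = (b * c)⁻¹ * ((b * c) * (a⁻¹ * b * c * d⁻¹ * c) * (b * c)⁻¹) ^ 4 * (b * c) := by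
        rw [conj_pow]; simp [mul_assoc]
    _ = (b * c)⁻¹ * ((a * b * c * d) ^ 10 * (b * c)) := by
      rw [hbeta, hleft, hright]; simp only [mul_assoc]
    _ = (a * b * c * d) ^ 10 := by rw [hcomm.eq, inv_mul_cancel_left]

end BraidIdentities
/-! ### A group of exponent three and nilpotency class three -/

/-- Pairs `(h, v)` with `v` in the exterior algebra of `𝔽₃²` and `h = 1 + α e₁ + β e₂ + γ e₁ e₂` a
unit of it acting by affine maps `w ↦ h w + v`. -/
@[ext]
structure ExteriorAffine where
  (α β γ v₀ v₁ v₂ v₃ : ZMod 3)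
  deriving DecidableEq

namespace ExteriorAffine

instance : Mul ExteriorAffine where
  mul p q := ⟨p.α + q.α, p.β + q.β, p.γ + q.γ + p.α * q.β - p.β * q.α, p.v₀ + q.v₀,
    p.v₁ + q.v₁ + p.α * q.v₀, p.v₂ + q.v₂ + p.β * q.v₀,
    p.v₃ + q.v₃ + p.γ * q.v₀ + p.α * q.v₂ - p.β * q.v₁⟩

instance : One ExteriorAffine := ⟨⟨0, 0, 0, 0, 0, 0, 0⟩⟩

theorem mul_def (p q : ExteriorAffine) :
    p * q = ⟨p.α + q.α, p.β + q.β, p.γ + q.γ + p.α * q.β - p.β * q.α, p.v₀ + q.v₀,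
      p.v₁ + q.v₁ + p.α * q.v₀, p.v₂ + q.v₂ + p.β * q.v₀,
      p.v₃ + q.v₃ + p.γ * q.v₀ + p.α * q.v₂ - p.β * q.v₁⟩ := rfl

theorem one_def : (1 : ExteriorAffine) = ⟨0, 0, 0, 0, 0, 0, 0⟩ := rfl

/-- With `h = 1 + ν`, anticommutativity of `e₁` and `e₂` gives `ν² = 0`, so `h³ = 1 + 3ν` and `(1 +
h + h²) v = 3 (1 + ν) v`; both corrections vanish modulo three. -/
theorem cube_eq_one (p : ExteriorAffine) : p * p * p = 1 := by
  have h : (3 : ZMod 3) = 0 := rfl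
  rw [mul_def, mul_def, one_def]
  ext
  · linear_combination p.α * h
  · linear_combination p.β * h
  · linear_combination p.γ * h
  · linear_combination p.v₀ * h
  · linear_combination (p.v₁ + p.α * p.v₀) * h
  · linear_combination (p.v₂ + p.β * p.v₀) * h
  · linear_combination (p.v₃ + p.γ * p.v₀ + p.α * p.v₂ - p.β * p.v₁) * h

instance : Inv ExteriorAffine := ⟨fun p => p * p⟩

instance : Group ExteriorAffine :=
  Group.ofLeftAxioms
    (by intro p q r; simp only [mul_def]; ext <;> ring)
    (by intro p; rw [mul_def, one_def]; ext <;> ring)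
    cube_eq_one

instance : Finite ExteriorAffine :=
  Finite.of_injective (fun p => (p.α, p.β, p.γ, p.v₀, p.v₁, p.v₂, p.v₃))
    (fun p q h => by simp only [Prod.mk.injEq] at h; ext <;> simp [h])

theorem pow_three_eq_one (p : ExteriorAffine) : p ^ 3 = 1 := by
  rw [pow_succ, pow_two, cube_eq_one]

/-- For the translation by `1` and the multiplications by `1 + e₁` and `1 + e₂`, with `x = 1`, the
word `P` is the translation by `-e₁e₂`. -/
theorem wordP_ne_one :
    wordP (1 : ExteriorAffine) ⟨0, 0, 0, 1, 0, 0, 0⟩ ⟨1, 0, 0, 0, 0, 0, 0⟩ ⟨0, 1, 0, 0, 0, 0, 0⟩ ≠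
      1 := by
  decide

end ExteriorAffine

/-! ### Universal properties of Burnside quotients -/

section BurnsideQuotient

variable {n : ℕ} {G H : Type*} [Group G] [Group H]

theorem BurnsideQuotient.pow_eq_one (x : BurnsideQuotient n G) : x ^ n = 1 := by
  induction x using QuotientGroup.induction_on with
  | H g =>
    rw [← QuotientGroup.mk_pow, QuotientGroup.eq_one_iff]
    exact Subgroup.subset_normalClosure ⟨g, rfl⟩

/-- A homomorphism to a group of exponent `n` factors through the Burnside quotient. -/
def BurnsideQuotient.lift (hH : ∀ h : H, h ^ n = 1) (φ : G →* H) : BurnsideQuotient n G →* H :=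
  QuotientGroup.lift _ φ (fun x hx => by
    have : Subgroup.normalClosure (Set.range fun a : G => a ^ n) ≤ φ.ker := by
      apply Subgroup.normalClosure_le_normal
      rintro _ ⟨a, rfl⟩
      simp [MonoidHom.mem_ker, hH]
    exact this hx)

@[simp]
theorem BurnsideQuotient.lift_mk (hH : ∀ h : H, h ^ n = 1) (φ : G →* H) (g : G) :
    BurnsideQuotient.lift hH φ (QuotientGroup.mk g) = φ g := rfl

end BurnsideQuotient

theorem map_wordP {G H : Type*} [Group G] [Group H] (φ : G →* H) (x y z t : G) :
    φ (wordP x y z t) = wordP (φ x) (φ y) (φ z) (φ t) := by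
  simp [wordP]

theorem elementP_ne_one : elementP ≠ 1 := by
  intro h
  let f : Fin 4 → ExteriorAffine :=
    ![1, ⟨0, 0, 0, 1, 0, 0, 0⟩, ⟨1, 0, 0, 0, 0, 0, 0⟩, ⟨0, 1, 0, 0, 0, 0, 0⟩]
  have := congrArg (BurnsideQuotient.lift ExteriorAffine.pow_three_eq_one (FreeGroup.lift f)) h
  rw [elementP, map_wordP, map_one] at this
  simp only [FreeBurnside.gen, BurnsideQuotient.lift_mk, FreeGroup.lift_apply_of] at this
  exact ExteriorAffine.wordP_ne_one this

/-! ### Colorings of stacks of slices by a group -/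

section Colorings

variable {G H : Type*} [Group G] [Group H]

/-- The core relation between the colors at the bottom and at the top of an elementary slice
without strands to its left. -/
def LocalRel : Kind → List H → List H → Prop
  | .cup, x, y => ∃ a, y = a :: a :: x
  | .cap, x, y => ∃ a, x = a :: a :: y
  | .crossing true, x, y => ∃ a b q, x = a :: b :: q ∧ y = (a * b⁻¹ * a) :: a :: q
  | .crossing false, x, y => ∃ a b q, x = b :: a :: q ∧ y = a :: (a * b⁻¹ * a) :: q

/-- The core relation between the colors at the bottom and at the top of an elementary slice. -/
def SliceRel : ℕ → Kind → List H → List H → Prop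
  | 0, k, x, y => LocalRel k x y
  | i + 1, k, x, y => ∃ c x' y', x = c :: x' ∧ y = c :: y' ∧ SliceRel i k x' y'

/-- `Conn w x y`: some coloring of the stack `w` has the colors `x` at the bottom and `y` at the
top. -/
def Conn : List Slice → List H → List H → Prop
  | [], x, y => x = y
  | s :: w, x, y => ∃ m, SliceRel s.pos s.kind x m ∧ Conn w m y

/-- `Colors w x ms y`: `ms` lists the colors above each slice in a coloring of `w` with the colors
`x` at the bottom and `y` at the top. -/
def Colors : List Slice → List H → List (List H) → List H → Prop
  | [], x, ms, y => ms = [] ∧ x = y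
  | s :: w, x, ms, y => ∃ m ms', ms = m :: ms' ∧ SliceRel s.pos s.kind x m ∧ Colors w m ms' y

theorem conn_iff_exists_colors {w : List Slice} {x y : List H} :
    Conn w x y ↔ ∃ ms, Colors w x ms y := by
  induction w generalizing x with
  | nil => simp [Conn, Colors]
  | cons s w ih =>
    simp only [Conn, Colors, ih]
    constructor
    · rintro ⟨m, h, ms, h'⟩
      exact ⟨m :: ms, m, ms, rfl, h, h'⟩
    · rintro ⟨_, m, ms, rfl, h, h'⟩
      exact ⟨m, h, ms, h'⟩

theorem conn_append {u v : List Slice} {x y : List H} :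
    Conn (u ++ v) x y ↔ ∃ z, Conn u x z ∧ Conn v z y := by
  induction u generalizing x with
  | nil => simp [Conn]
  | cons s u ih =>
    simp only [List.cons_append, Conn, ih]
    constructor
    · rintro ⟨m, h, z, h1, h2⟩
      exact ⟨z, ⟨m, h, h1⟩, h2⟩
    · rintro ⟨z, ⟨m, h, h1⟩, h2⟩
      exact ⟨m, h, z, h1, h2⟩

theorem colors_append {u v : List Slice} {x y : List H} {ms : List (List H)} :
    Colors (u ++ v) x ms y ↔
      ∃ m₁ m₂ z, ms = m₁ ++ m₂ ∧ Colors u x m₁ z ∧ Colors v z m₂ y := by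
  induction u generalizing x ms with
  | nil => simp [Colors]
  | cons s u ih =>
    simp only [List.cons_append, Colors, ih]
    constructor
    · rintro ⟨m, _, rfl, h, m₁, m₂, z, rfl, h1, h2⟩
      exact ⟨m :: m₁, m₂, z, rfl, ⟨m, m₁, rfl, h, h1⟩, h2⟩
    · rintro ⟨_, m₂, z, rfl, ⟨m, m₁, rfl, h, h1⟩, h2⟩
      exact ⟨m, m₁ ++ m₂, rfl, h, m₁, m₂, z, rfl, h1, h2⟩

theorem LocalRel.map (φ : G →* H) {k : Kind} {x y : List G} (h : LocalRel k x y) :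
    LocalRel k (x.map φ) (y.map φ) := by
  match k, h with
  | .cup, ⟨a, h⟩ => subst h; exact ⟨φ a, by simp⟩
  | .cap, ⟨a, h⟩ => subst h; exact ⟨φ a, by simp⟩
  | .crossing true, ⟨a, b, q, h, h'⟩ => subst h h'; exact ⟨φ a, φ b, q.map φ, by simp, by simp⟩
  | .crossing false, ⟨a, b, q, h, h'⟩ => subst h h'; exact ⟨φ a, φ b, q.map φ, by simp, by simp⟩

theorem SliceRel.map (φ : G →* H) {i : ℕ} {k : Kind} {x y : List G} (h : SliceRel i k x y) :
    SliceRel i k (x.map φ) (y.map φ) := by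
  induction i generalizing x y with
  | zero => exact LocalRel.map φ h
  | succ i ih =>
    obtain ⟨c, x', y', rfl, rfl, h⟩ := h
    exact ⟨φ c, x'.map φ, y'.map φ, by simp, by simp, ih h⟩

theorem Colors.map (φ : G →* H) {w : List Slice} {x y : List G} {ms : List (List G)}
    (h : Colors w x ms y) : Colors w (x.map φ) (ms.map (List.map φ)) (y.map φ) := by
  induction w generalizing x ms with
  | nil => obtain ⟨rfl, rfl⟩ := h; exact ⟨rfl, rfl⟩
  | cons s w ih =>
    obtain ⟨m, ms', rfl, h1, h2⟩ := h
    exact ⟨m.map φ, ms'.map (List.map φ), by simp, h1.map φ, ih h2⟩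

theorem SliceRel.length {i : ℕ} {k : Kind} {x y : List H} (h : SliceRel i k x y) :
    i + k.bottom ≤ x.length ∧ y.length = x.length - k.bottom + k.top := by
  induction i generalizing x y with
  | zero =>
    match k, h with
    | .cup, ⟨a, h⟩ => subst h; simp [Kind.bottom, Kind.top]
    | .cap, ⟨a, h⟩ => subst h; simp [Kind.bottom, Kind.top]
    | .crossing true, ⟨a, b, q, h, h'⟩ => subst h h'; simp [Kind.bottom, Kind.top]
    | .crossing false, ⟨a, b, q, h, h'⟩ => subst h h'; simp [Kind.bottom, Kind.top]
  | succ i ih =>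
    obtain ⟨c, x', y', rfl, rfl, h⟩ := h
    have := ih h
    simp only [List.length_cons]
    omega

theorem Conn.width {w : List Slice} {x y : List H} (h : Conn w x y) :
    width w x.length = some y.length := by
  induction w generalizing x with
  | nil => simp [LinkDiag.width, show x = y from h]
  | cons s w ih =>
    obtain ⟨m, h1, h2⟩ := h
    have := h1.length
    rw [LinkDiag.width, if_pos this.1, ← this.2, ih h2]

theorem Colors.conn {w : List Slice} {x y : List H} {ms : List (List H)}
    (h : Colors w x ms y) : Conn w x y :=
  conn_iff_exists_colors.2 ⟨ms, h⟩

theorem Colors.length {w : List Slice} {x y : List H} {ms : List (List H)}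
    (h : Colors w x ms y) : ms.length = w.length := by
  induction w generalizing x ms with
  | nil => simp [h.1]
  | cons s w ih =>
    obtain ⟨m, ms', rfl, -, h⟩ := h
    simp [ih h]

/-! #### Strands to the left and to the right -/

theorem sliceRel_append_left {i j : ℕ} {k : Kind} {p x y : List H} (hp : p.length = i) :
    SliceRel (i + j) k (p ++ x) y ↔ ∃ y', y = p ++ y' ∧ SliceRel j k x y' := by
  induction p generalizing i y with
  | nil => subst hp; simp
  | cons c p ih =>
    subst hp
    rw [List.length_cons, Nat.add_right_comm]
    simp only [SliceRel, List.cons_append, List.cons.injEq]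
    constructor
    · rintro ⟨_, _, y', ⟨rfl, rfl⟩, rfl, h⟩
      obtain ⟨y'', rfl, h₁⟩ := (ih rfl).1 h
      exact ⟨y'', rfl, h₁⟩
    · rintro ⟨y', rfl, h⟩
      exact ⟨c, p ++ x, p ++ y', ⟨rfl, rfl⟩, rfl, (ih rfl).2 ⟨y', rfl, h⟩⟩

def Slice.shift (i : ℕ) (s : Slice) : Slice := ⟨i + s.pos, s.kind⟩

theorem conn_append_left {w : List Slice} {i : ℕ} {p x y : List H} (hp : p.length = i) :
    Conn (w.map (Slice.shift i)) (p ++ x) y ↔ ∃ y', y = p ++ y' ∧ Conn w x y' := by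
  induction w generalizing x with
  | nil => simp [Conn, eq_comm]
  | cons s w ih =>
    simp only [List.map_cons, Conn, Slice.shift, sliceRel_append_left hp]
    constructor
    · rintro ⟨_, ⟨m, rfl, h⟩, h'⟩
      obtain ⟨y', rfl, h₁⟩ := ih.1 h'
      exact ⟨y', rfl, m, h, h₁⟩
    · rintro ⟨y', rfl, m, h, h'⟩
      exact ⟨p ++ m, ⟨m, rfl, h⟩, ih.2 ⟨y', rfl, h'⟩⟩

/-! #### Uniqueness of colorings -/

theorem SliceRel.unique_top {i : ℕ} {k : Kind} (hk : k ≠ .cup) {x y y' : List H}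
    (h : SliceRel i k x y) (h' : SliceRel i k x y') : y = y' := by
  induction i generalizing x y y' with
  | zero =>
    match k, h, h' with
    | .cap, ⟨a, h⟩, ⟨a', h'⟩ => simp_all
    | .crossing true, ⟨a, b, q, h1, h2⟩, ⟨a', b', q', h1', h2'⟩ => simp_all
    | .crossing false, ⟨a, b, q, h1, h2⟩, ⟨a', b', q', h1', h2'⟩ => simp_all
  | succ i ih =>
    obtain ⟨c, x₁, y₁, rfl, rfl, h⟩ := h
    obtain ⟨c', x₁', y₁', hx, rfl, h'⟩ := h'
    obtain ⟨rfl, rfl⟩ := List.cons.inj hx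
    rw [ih h h']

theorem SliceRel.unique_bottom {i : ℕ} {k : Kind} (hk : k ≠ .cap) {x x' y : List H}
    (h : SliceRel i k x y) (h' : SliceRel i k x' y) : x = x' := by
  induction i generalizing x x' y with
  | zero =>
    match k, h, h' with
    | .cup, ⟨a, h⟩, ⟨a', h'⟩ => simp_all
    | .crossing true, ⟨a, b, q, h1, h2⟩, ⟨a', b', q', h1', h2'⟩ =>
      subst h1 h2 h1'
      simp only [List.cons.injEq] at h2'
      obtain ⟨h, rfl, rfl⟩ := h2'
      simpa using h
    | .crossing false, ⟨a, b, q, h1, h2⟩, ⟨a', b', q', h1', h2'⟩ =>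
      subst h1 h2 h1'
      simp only [List.cons.injEq] at h2'
      obtain ⟨rfl, h, rfl⟩ := h2'
      simpa using h
  | succ i ih =>
    obtain ⟨c, x₁, y₁, rfl, rfl, h⟩ := h
    obtain ⟨c', x₁', y₁', rfl, hy, h'⟩ := h'
    obtain ⟨rfl, rfl⟩ := List.cons.inj hy
    rw [ih h h']

/-- For `i = j` the minimum and the maximum close up to a circle of arbitrary color. Otherwise every
strand on the middle line belongs to an arc that reaches the bottom or the top. -/
theorem SliceRel.unique_between {i j : ℕ} (hij : i ≠ j) {x m m' y : List H}
    (h₁ : SliceRel j .cup x m) (h₁' : SliceRel j .cup x m')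
    (h₂ : SliceRel i .cap m y) (h₂' : SliceRel i .cap m' y) : m = m' := by
  induction i generalizing j x m m' y with
  | zero =>
    obtain ⟨j, rfl⟩ := Nat.exists_eq_succ_of_ne_zero hij.symm
    obtain ⟨a, rfl⟩ := h₂
    obtain ⟨a', rfl⟩ := h₂'
    obtain ⟨c, x₁, y₁, rfl, hy, -⟩ := h₁
    obtain ⟨c', x₁', y₁', hx', hy', -⟩ := h₁'
    simp_all
  | succ i ih =>
    obtain ⟨c, m₁, y₁, rfl, rfl, h₂⟩ := h₂
    obtain ⟨c', m₁', y₁', rfl, hy, h₂'⟩ := h₂'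
    obtain ⟨rfl, rfl⟩ := List.cons.inj hy
    cases j with
    | zero =>
      obtain ⟨a, h⟩ := h₁
      obtain ⟨a', h'⟩ := h₁'
      simp_all
    | succ j =>
      obtain ⟨d, x₁, z, rfl, hz, h₁⟩ := h₁
      obtain ⟨d', x₁', z', hx', hz', h₁'⟩ := h₁'
      obtain ⟨rfl, rfl⟩ := List.cons.inj hz
      obtain ⟨rfl, rfl⟩ := List.cons.inj hz'
      obtain ⟨-, rfl⟩ := List.cons.inj hx'
      rw [ih (by omega) h₁ h₁' h₂ h₂']

theorem Colors.unique_top {w : List Slice} (hw : ∀ s ∈ w, s.kind ≠ .cup) {x y y' : List H}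
    {ms ms' : List (List H)} (h : Colors w x ms y) (h' : Colors w x ms' y') :
    ms = ms' ∧ y = y' := by
  induction w generalizing x ms ms' with
  | nil => obtain ⟨rfl, rfl⟩ := h; obtain ⟨rfl, rfl⟩ := h'; exact ⟨rfl, rfl⟩
  | cons s w ih =>
    obtain ⟨m, n, rfl, h1, h2⟩ := h
    obtain ⟨m', n', rfl, h1', h2'⟩ := h'
    obtain rfl := h1.unique_top (hw s (by simp)) h1'
    obtain ⟨rfl, rfl⟩ := ih (fun s hs => hw s (by simp [hs])) h2 h2'
    exact ⟨rfl, rfl⟩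

theorem Colors.unique_bottom {w : List Slice} (hw : ∀ s ∈ w, s.kind ≠ .cap) {x x' y : List H}
    {ms ms' : List (List H)} (h : Colors w x ms y) (h' : Colors w x' ms' y) :
    ms = ms' ∧ x = x' := by
  induction w generalizing x x' ms ms' with
  | nil => obtain ⟨rfl, rfl⟩ := h; obtain ⟨rfl, rfl⟩ := h'; exact ⟨rfl, rfl⟩
  | cons s w ih =>
    obtain ⟨m, n, rfl, h1, h2⟩ := h
    obtain ⟨m', n', rfl, h1', h2'⟩ := h'
    obtain ⟨rfl, rfl⟩ := ih (fun s hs => hw s (by simp [hs])) h2 h2'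
    exact ⟨rfl, h1.unique_bottom (hw s (by simp)) h1'⟩

/-- A coloring of two slices, other than a minimum and a maximum at the same place, is determined
by the colors at the bottom and at the top. -/
theorem Colors.unique_pair {i j : ℕ} {k l : Kind} (h : k ≠ .cup ∨ l ≠ .cap ∨ i ≠ j)
    {x y : List H} {ms ms' : List (List H)} (hc : Colors [⟨j, k⟩, ⟨i, l⟩] x ms y)
    (hc' : Colors [⟨j, k⟩, ⟨i, l⟩] x ms' y) : ms = ms' := by
  obtain ⟨m, _, rfl, h1, n, _, rfl, h2, rfl, rfl⟩ := hc
  obtain ⟨m', _, rfl, h1', n', _, rfl, h2', rfl, rfl⟩ := hc'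
  have : m = m' := by
    by_cases hk : k = .cup
    · by_cases hl : l = .cap
      · subst hk hl
        exact h1.unique_between (by simpa using h) h1' h2 h2'
      · exact h2.unique_bottom hl h2'
    · exact h1.unique_top hk h1'
  rw [this]

/-- Neither side of a move contains a closed circle, so the boundary determines the inner colors.
This makes the passage of colorings across a move reversible. -/
theorem Rule.colors_unique {n : ℕ} {l r : List Slice} (h : Rule n l r) {x y : List H}
    {ms ms' : List (List H)} :
    (Colors l x ms y → Colors l x ms' y → ms = ms') ∧
      (Colors r x ms y → Colors r x ms' y → ms = ms') := by
  have hnil : Colors [] x ms y → Colors [] x ms' y → ms = ms' := fun h h' => by rw [h.1, h'.1]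
  cases h with
  | isotopy h =>
    cases h with
    | exchange A B i d =>
      refine ⟨Colors.unique_pair ?_, Colors.unique_pair ?_⟩ <;>
        cases A <;> cases B <;> simp [Kind.bottom, Kind.top] <;> omega
    | zigzag_left i => exact ⟨Colors.unique_pair (by simp), hnil⟩
    | zigzag_right i => exact ⟨Colors.unique_pair (by simp), hnil⟩
    | slide_cap i s => exact ⟨Colors.unique_pair (by simp), Colors.unique_pair (by simp)⟩
    | slide_cup i s => exact ⟨Colors.unique_pair (by simp), Colors.unique_pair (by simp)⟩
    | reidemeister_one_cap i s =>
      exact ⟨Colors.unique_pair (by simp),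
        fun h h' => (Colors.unique_top (by simp [cap]) h h').1⟩
    | reidemeister_one_cup i s =>
      exact ⟨Colors.unique_pair (by simp),
        fun h h' => (Colors.unique_bottom (by simp [cup]) h h').1⟩
    | reidemeister_two i s => exact ⟨Colors.unique_pair (by simp), hnil⟩
    | reidemeister_three i s₁ s₂ s₃ _ =>
      exact ⟨fun h h' => (Colors.unique_top (by simp [cross]) h h').1,
        fun h h' => (Colors.unique_top (by simp [cross]) h h').1⟩
  | nMove i s =>
    refine ⟨fun h h' => (Colors.unique_top ?_ h h').1, hnil⟩
    intro t ht
    rw [List.eq_of_mem_replicate ht]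
    simp [cross]

end Colorings
/-! ### Invariance of colorings under the moves -/

theorem exists_append_of_le {α : Type*} {i : ℕ} {x : List α} (h : i ≤ x.length) :
    ∃ p x', x = p ++ x' ∧ p.length = i :=
  ⟨x.take i, x.drop i, (List.take_append_drop i x).symm, by simp [h]⟩

theorem exists_cons_of_le {α : Type*} {n : ℕ} {x : List α} (h : n + 1 ≤ x.length) :
    ∃ a x', x = a :: x' ∧ n ≤ x'.length := by
  cases x with
  | nil => simp at h
  | cons a x => exact ⟨a, x, rfl, by simpa using h⟩

section Invariance

variable {H : Type*} [Group H]

/-- To compare two stacks of slices one may delete strands on the left. -/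
theorem conn_iff_conn_of_shift {l r l₀ r₀ : List Slice} {i : ℕ}
    (hl : l = l₀.map (Slice.shift i)) (hr : r = r₀.map (Slice.shift i)) {x y : List H}
    (hi : i ≤ x.length)
    (h : ∀ x' y' : List H, x'.length = x.length - i → (Conn l₀ x' y' ↔ Conn r₀ x' y')) :
    Conn l x y ↔ Conn r x y := by
  obtain ⟨p, x', rfl, hp⟩ := exists_append_of_le hi
  subst hl hr
  rw [conn_append_left hp, conn_append_left hp]
  refine exists_congr fun y' => and_congr_right fun _ => h x' y' ?_
  simp [hp]

theorem conn_exchange (A B : Kind) (d : ℕ) (x y : List H) :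
    Conn [⟨A.bottom + d, B⟩, ⟨0, A⟩] x y ↔ Conn [⟨0, A⟩, ⟨A.top + d, B⟩] x y := by
  have h2 : 2 + d = d + 1 + 1 := by omega
  match A with
  | .cup =>
    simp only [Conn, SliceRel, LocalRel, Kind.bottom, Kind.top, h2, zero_add]
    constructor
    · rintro ⟨m, h, _, ⟨a, rfl⟩, rfl⟩
      exact ⟨_, ⟨a, rfl⟩, _, ⟨a, _, _, rfl, rfl, a, _, _, rfl, rfl, h⟩, rfl⟩
    · rintro ⟨_, ⟨a, rfl⟩, _, ⟨_, _, _, hx, rfl, _, _, m, rfl, rfl, h⟩, rfl⟩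
      simp only [List.cons.injEq] at hx
      obtain ⟨rfl, rfl, rfl⟩ := hx
      exact ⟨m, h, _, ⟨a, rfl⟩, rfl⟩
  | .cap =>
    simp only [Conn, SliceRel, LocalRel, Kind.bottom, Kind.top, h2, zero_add]
    constructor
    · rintro ⟨_, ⟨c, _, _, rfl, rfl, c', x', y', rfl, rfl, h⟩, _, ⟨a, hx⟩, rfl⟩
      simp only [List.cons.injEq] at hx
      obtain ⟨rfl, rfl, rfl⟩ := hx
      exact ⟨x', ⟨_, rfl⟩, _, h, rfl⟩
    · rintro ⟨m, ⟨a, rfl⟩, y', h, rfl⟩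
      exact ⟨_, ⟨a, _, _, rfl, rfl, a, _, _, rfl, rfl, h⟩, _, ⟨a, rfl⟩, rfl⟩
  | .crossing true =>
    simp only [Conn, SliceRel, LocalRel, Kind.bottom, Kind.top, h2]
    constructor
    · rintro ⟨_, ⟨c, _, _, rfl, rfl, c', x', y', rfl, rfl, h⟩, _, ⟨a, b, q, hx, rfl⟩, rfl⟩
      simp only [List.cons.injEq] at hx
      obtain ⟨rfl, rfl, rfl⟩ := hx
      exact ⟨_, ⟨_, _, _, rfl, rfl⟩, _, ⟨_, _, _, rfl, rfl, _, _, _, rfl, rfl, h⟩, rfl⟩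
    · rintro ⟨_, ⟨a, b, q, rfl, rfl⟩, _, ⟨c, _, _, hx, rfl, c', _, y', rfl, rfl, h⟩, rfl⟩
      simp only [List.cons.injEq] at hx
      obtain ⟨rfl, rfl, rfl⟩ := hx
      exact ⟨_, ⟨_, _, _, rfl, rfl, _, _, _, rfl, rfl, h⟩, _, ⟨_, _, _, rfl, rfl⟩, rfl⟩
  | .crossing false =>
    simp only [Conn, SliceRel, LocalRel, Kind.bottom, Kind.top, h2]
    constructor
    · rintro ⟨_, ⟨c, _, _, rfl, rfl, c', x', y', rfl, rfl, h⟩, _, ⟨a, b, q, hx, rfl⟩, rfl⟩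
      simp only [List.cons.injEq] at hx
      obtain ⟨rfl, rfl, rfl⟩ := hx
      exact ⟨_, ⟨_, _, _, rfl, rfl⟩, _, ⟨_, _, _, rfl, rfl, _, _, _, rfl, rfl, h⟩, rfl⟩
    · rintro ⟨_, ⟨a, b, q, rfl, rfl⟩, _, ⟨c, _, _, hx, rfl, c', _, y', rfl, rfl, h⟩, rfl⟩
      simp only [List.cons.injEq] at hx
      obtain ⟨rfl, rfl, rfl⟩ := hx
      exact ⟨_, ⟨_, _, _, rfl, rfl, _, _, _, rfl, rfl, h⟩, _, ⟨_, _, _, rfl, rfl⟩, rfl⟩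

theorem conn_zigzag_left (a : H) (q y : List H) :
    Conn [cup 0, cap 1] (a :: q) y ↔ Conn [] (a :: q) y := by
  simp [Conn, SliceRel, LocalRel, cup, cap, eq_comm]

theorem conn_zigzag_right (a : H) (q y : List H) :
    Conn [cup 1, cap 0] (a :: q) y ↔ Conn [] (a :: q) y := by
  simp [Conn, SliceRel, LocalRel, cup, cap]

theorem conn_slide_cap (s : Bool) (x y : List H) :
    Conn [cross 0 s, cap 1] x y ↔ Conn [cross 1 (!s), cap 0] x y := by
  cases s <;> simp only [Conn, SliceRel, LocalRel, cross, cap] <;> constructor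
  · rintro ⟨_, ⟨a, b, _, rfl, rfl⟩, _, ⟨c, _, y', hx, rfl, d, rfl⟩, rfl⟩
    simp only [List.cons.injEq] at hx
    obtain ⟨rfl, rfl, rfl⟩ := hx
    exact ⟨_, ⟨_, _, _, rfl, rfl, _, _, _, rfl, rfl⟩, _, ⟨b, by simp [mul_assoc]⟩, rfl⟩
  · rintro ⟨_, ⟨c, _, _, rfl, rfl, a, d, q, rfl, rfl⟩, _, ⟨e, hx⟩, rfl⟩
    simp only [List.cons.injEq] at hx
    obtain ⟨rfl, rfl, rfl⟩ := hx
    exact ⟨_, ⟨_, _, _, rfl, rfl⟩, _, ⟨_, _, _, rfl, rfl, d, by simp [mul_assoc]⟩, rfl⟩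
  · rintro ⟨_, ⟨a, b, _, rfl, rfl⟩, _, ⟨c, _, y', hx, rfl, d, rfl⟩, rfl⟩
    simp only [List.cons.injEq] at hx
    obtain ⟨rfl, rfl, rfl⟩ := hx
    exact ⟨_, ⟨_, _, _, rfl, rfl, _, _, _, rfl, rfl⟩, _, ⟨_, rfl⟩, rfl⟩
  · rintro ⟨_, ⟨c, _, _, rfl, rfl, a, d, q, rfl, rfl⟩, _, ⟨e, hx⟩, rfl⟩
    simp only [List.cons.injEq] at hx
    obtain ⟨rfl, rfl, rfl⟩ := hx
    exact ⟨_, ⟨_, _, _, rfl, rfl⟩, _, ⟨_, _, _, rfl, rfl, _, rfl⟩, rfl⟩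

theorem conn_slide_cup (s : Bool) (x y : List H) :
    Conn [cup 1, cross 0 s] x y ↔ Conn [cup 0, cross 1 (!s)] x y := by
  cases s <;> simp only [Conn, SliceRel, LocalRel, cross, cup] <;> constructor
  · rintro ⟨_, ⟨c, q, _, rfl, rfl, a, rfl⟩, _, ⟨d, b, _, hx, rfl⟩, rfl⟩
    simp only [List.cons.injEq] at hx
    obtain ⟨rfl, rfl, rfl⟩ := hx
    exact ⟨_, ⟨a, rfl⟩, _, ⟨a, _, _, rfl, rfl, _, _, _, rfl, rfl⟩, rfl⟩
  · rintro ⟨_, ⟨a, rfl⟩, _, ⟨c, _, _, hx, rfl, d, e, q, rfl, rfl⟩, rfl⟩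
    simp only [List.cons.injEq] at hx
    obtain ⟨rfl, rfl, rfl⟩ := hx
    exact ⟨_, ⟨e, q, _, rfl, rfl, a, rfl⟩, _, ⟨a, e, _, rfl, rfl⟩, by simp⟩
  · rintro ⟨_, ⟨c, q, _, rfl, rfl, a, rfl⟩, _, ⟨d, b, _, hx, rfl⟩, rfl⟩
    simp only [List.cons.injEq] at hx
    obtain ⟨rfl, rfl, rfl⟩ := hx
    exact ⟨_, ⟨c * a⁻¹ * c, rfl⟩, _, ⟨_, _, _, rfl, rfl, _, _, _, rfl, rfl⟩,
      by simp [mul_assoc]⟩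
  · rintro ⟨_, ⟨a, rfl⟩, _, ⟨c, _, _, hx, rfl, d, e, q, rfl, rfl⟩, rfl⟩
    simp only [List.cons.injEq] at hx
    obtain ⟨rfl, rfl, rfl⟩ := hx
    exact ⟨_, ⟨d, q, _, rfl, rfl, d * a⁻¹ * d, rfl⟩, _, ⟨_, _, _, rfl, rfl⟩,
      by simp [mul_assoc]⟩

theorem conn_reidemeister_one_cap (s : Bool) (x y : List H) :
    Conn [cross 0 s, cap 0] x y ↔ Conn [cap 0] x y := by
  cases s <;> simp only [Conn, SliceRel, LocalRel, cross, cap, exists_eq_right] <;> constructor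
  · rintro ⟨_, ⟨a, b, q, rfl, rfl⟩, c, h⟩
    simp only [List.cons.injEq] at h
    obtain ⟨rfl, h, rfl⟩ := h
    obtain rfl : a = b := by simpa [mul_inv_eq_one] using h
    exact ⟨a, rfl⟩
  · rintro ⟨a, rfl⟩
    exact ⟨_, ⟨a, a, _, rfl, rfl⟩, a, by simp⟩
  · rintro ⟨_, ⟨a, b, q, rfl, rfl⟩, c, h⟩
    simp only [List.cons.injEq] at h
    obtain ⟨rfl, h, rfl⟩ := h
    obtain rfl : a = b := by simpa [mul_inv_eq_one] using h.symm
    exact ⟨a, rfl⟩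
  · rintro ⟨a, rfl⟩
    exact ⟨_, ⟨a, a, _, rfl, rfl⟩, a, by simp⟩

theorem conn_reidemeister_one_cup (s : Bool) (x y : List H) :
    Conn [cup 0, cross 0 s] x y ↔ Conn [cup 0] x y := by
  cases s <;> simp [Conn, SliceRel, LocalRel, cross, cup]

theorem conn_reidemeister_two (s : Bool) (a b : H) (q y : List H) :
    Conn [cross 0 s, cross 0 (!s)] (a :: b :: q) y ↔ Conn [] (a :: b :: q) y := by
  cases s <;> simp [Conn, SliceRel, LocalRel, cross, mul_assoc, eq_comm]

theorem conn_reidemeister_three (s₁ s₂ s₃ : Bool) (h : s₂ = s₁ ∨ s₂ = s₃) (x y : List H) :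
    Conn [cross 0 s₁, cross 1 s₂, cross 0 s₃] x y ↔
      Conn [cross 1 s₃, cross 0 s₂, cross 1 s₁] x y := by
  -- The hypothesis removes the two sign patterns `s₁ = s₃ ≠ s₂`, in which no strand is the top one;
  -- the other six are computed.
  cases s₁ <;> cases s₂ <;> cases s₃ <;> simp at h <;>
    simp [Conn, SliceRel, LocalRel, cross] <;> constructor <;>
    · rintro ⟨a, b, c, q, rfl, rfl⟩
      exact ⟨_, _, _, _, rfl, by simp [mul_assoc]⟩

/-- The action of `n` half twists on a pair of strands. -/
theorem conn_replicate_cross_true (n : ℕ) (a b : H) (q y : List H) :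
    Conn (List.replicate n (cross 0 true)) (a :: b :: q) y ↔
      y = (a * b⁻¹) ^ n * a :: (a * b⁻¹) ^ n * b :: q := by
  induction n generalizing a b with
  | zero => simp [Conn, eq_comm]
  | succ n ih =>
    rw [List.replicate_succ, Conn]
    have : ∀ m, SliceRel (cross 0 true).pos (cross 0 true).kind (a :: b :: q) m ↔
        m = (a * b⁻¹ * a) :: a :: q := by
      simp [SliceRel, LocalRel, cross]
    simp only [this, exists_eq_left, ih]
    simp [pow_succ, mul_assoc]

theorem conn_replicate_cross_false (n : ℕ) (a b : H) (q y : List H) :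
    Conn (List.replicate n (cross 0 false)) (b :: a :: q) y ↔
      y = (a * b⁻¹) ^ n * b :: (a * b⁻¹) ^ n * a :: q := by
  induction n generalizing a b with
  | zero => simp [Conn, eq_comm]
  | succ n ih =>
    rw [List.replicate_succ, Conn]
    have : ∀ m, SliceRel (cross 0 false).pos (cross 0 false).kind (b :: a :: q) m ↔
        m = a :: (a * b⁻¹ * a) :: q := by
      simp [SliceRel, LocalRel, cross]
    simp only [this, exists_eq_left, ih]
    simp [pow_succ, mul_assoc]

/-- The half twists multiply both colors on the left by the same `n`th power. Among the moves, this
is the only one that needs the exponent of `H`. -/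
theorem conn_nMove {n : ℕ} (hH : ∀ h : H, h ^ n = 1) (s : Bool) (a b : H) (q y : List H) :
    Conn (List.replicate n (cross 0 s)) (a :: b :: q) y ↔ Conn [] (a :: b :: q) y := by
  cases s
  · simp [conn_replicate_cross_false, hH, Conn, eq_comm]
  · simp [conn_replicate_cross_true, hH, Conn, eq_comm]

theorem width_cons_eq_some {s : Slice} {w : List Slice} {n m : ℕ} :
    width (s :: w) n = some m ↔
      s.pos + s.kind.bottom ≤ n ∧ width w (n - s.kind.bottom + s.kind.top) = some m := by
  simp [width]

/-- The two sides of a move have the same colorings in groups of exponent `n`. -/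
theorem Rule.conn_iff {n : ℕ} (hn : n ≠ 0) (hH : ∀ h : H, h ^ n = 1) {l r : List Slice}
    (h : Rule n l r) {x y : List H} {m : ℕ} (hl : width l x.length = some m) :
    Conn l x y ↔ Conn r x y := by
  cases h with
  | isotopy h =>
    cases h with
    | exchange A B i d =>
      simp only [width_cons_eq_some] at hl
      refine conn_iff_conn_of_shift (i := i) (l₀ := [⟨A.bottom + d, B⟩, ⟨0, A⟩])
        (r₀ := [⟨0, A⟩, ⟨A.top + d, B⟩]) (by simp [Slice.shift, add_assoc])
        (by simp [Slice.shift, add_assoc]) (by omega) fun x' y' _ => conn_exchange A B d x' y'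
    | zigzag_left i =>
      simp only [width_cons_eq_some, cup, cap, Kind.bottom, Kind.top] at hl
      refine conn_iff_conn_of_shift (i := i) (l₀ := [cup 0, cap 1]) (r₀ := [])
        (by simp [Slice.shift, cup, cap]) (by simp) (by omega) fun x' y' hx => ?_
      obtain ⟨a, q, rfl, -⟩ := exists_cons_of_le (show 0 + 1 ≤ x'.length by omega)
      exact conn_zigzag_left a q y'
    | zigzag_right i =>
      simp only [width_cons_eq_some, cup, cap, Kind.bottom, Kind.top] at hl
      refine conn_iff_conn_of_shift (i := i) (l₀ := [cup 1, cap 0]) (r₀ := [])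
        (by simp [Slice.shift, cup, cap]) (by simp) (by omega) fun x' y' hx => ?_
      obtain ⟨a, q, rfl, -⟩ := exists_cons_of_le (show 0 + 1 ≤ x'.length by omega)
      exact conn_zigzag_right a q y'
    | slide_cap i s =>
      simp only [width_cons_eq_some, cross, cap, Kind.bottom, Kind.top] at hl
      exact conn_iff_conn_of_shift (i := i) (l₀ := [cross 0 s, cap 1])
        (r₀ := [cross 1 (!s), cap 0]) (by simp [Slice.shift, cross, cap])
        (by simp [Slice.shift, cross, cap]) (by omega) fun x' y' _ => conn_slide_cap s x' y'
    | slide_cup i s =>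
      simp only [width_cons_eq_some, cross, cup, Kind.bottom, Kind.top] at hl
      exact conn_iff_conn_of_shift (i := i) (l₀ := [cup 1, cross 0 s])
        (r₀ := [cup 0, cross 1 (!s)]) (by simp [Slice.shift, cross, cup])
        (by simp [Slice.shift, cross, cup]) (by omega) fun x' y' _ => conn_slide_cup s x' y'
    | reidemeister_one_cap i s =>
      simp only [width_cons_eq_some, cross, cap, Kind.bottom, Kind.top] at hl
      exact conn_iff_conn_of_shift (i := i) (l₀ := [cross 0 s, cap 0])
        (r₀ := [cap 0]) (by simp [Slice.shift, cross, cap])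
        (by simp [Slice.shift, cap]) (by omega) fun x' y' _ => conn_reidemeister_one_cap s x' y'
    | reidemeister_one_cup i s =>
      simp only [width_cons_eq_some, cross, cup, Kind.bottom, Kind.top] at hl
      exact conn_iff_conn_of_shift (i := i) (l₀ := [cup 0, cross 0 s])
        (r₀ := [cup 0]) (by simp [Slice.shift, cross, cup])
        (by simp [Slice.shift, cup]) (by omega) fun x' y' _ => conn_reidemeister_one_cup s x' y'
    | reidemeister_two i s =>
      simp only [width_cons_eq_some, cross, Kind.bottom, Kind.top] at hl
      refine conn_iff_conn_of_shift (i := i) (l₀ := [cross 0 s, cross 0 (!s)]) (r₀ := [])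
        (by simp [Slice.shift, cross]) (by simp) (by omega) fun x' y' hx => ?_
      obtain ⟨a, q, rfl, h1⟩ := exists_cons_of_le (show 1 + 1 ≤ x'.length by omega)
      obtain ⟨b, q, rfl, -⟩ := exists_cons_of_le (show 0 + 1 ≤ q.length by omega)
      exact conn_reidemeister_two s a b q y'
    | reidemeister_three i s₁ s₂ s₃ h =>
      simp only [width_cons_eq_some, cross, Kind.bottom, Kind.top] at hl
      exact conn_iff_conn_of_shift (i := i) (l₀ := [cross 0 s₁, cross 1 s₂, cross 0 s₃])
        (r₀ := [cross 1 s₃, cross 0 s₂, cross 1 s₁]) (by simp [Slice.shift, cross])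
        (by simp [Slice.shift, cross]) (by omega)
        fun x' y' _ => conn_reidemeister_three s₁ s₂ s₃ h x' y'
  | nMove i s =>
    obtain ⟨k, rfl⟩ := Nat.exists_eq_succ_of_ne_zero hn
    simp only [List.replicate_succ, width_cons_eq_some, cross,
      Kind.bottom] at hl
    refine conn_iff_conn_of_shift (i := i) (l₀ := List.replicate (k + 1) (cross 0 s)) (r₀ := [])
      (by simp [Slice.shift, cross]) (by simp) (by omega) fun x' y' hx => ?_
    obtain ⟨a, q, rfl, h1⟩ := exists_cons_of_le (show 1 + 1 ≤ x'.length by omega)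
    obtain ⟨b, q, rfl, -⟩ := exists_cons_of_le (show 0 + 1 ≤ q.length by omega)
    exact conn_nMove hH s a b q y'

end Invariance
/-! ### The universal coloring -/

section Universal

variable {G H : Type*} [Group G] [Group H]

/-- The colors at the `k`th horizontal line. -/
def level (ms : List (List H)) (k : ℕ) : List H := (([] : List H) :: ms).getD k []

theorem colors_of_levels {w : List Slice} (L : ℕ → List H)
    (h : ∀ k s, w[k]? = some s → SliceRel s.pos s.kind (L k) (L (k + 1))) :
    Colors w (L 0) ((List.range w.length).map fun k => L (k + 1)) (L w.length) := by
  induction w generalizing L with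
  | nil => exact ⟨rfl, rfl⟩
  | cons s w ih =>
    refine ⟨L 1, (List.range w.length).map fun k => L (k + 1 + 1), ?_, h 0 s rfl, ?_⟩
    · simp [List.range_succ_eq_map, Function.comp_def]
    · exact ih (fun k => L (k + 1)) fun k s hk => h (k + 1) s (by simpa using hk)

theorem Colors.sliceRel {w : List Slice} {x y : List H} {ms : List (List H)}
    (h : Colors w x ms y) {k : ℕ} {s : Slice} (hk : w[k]? = some s) :
    SliceRel s.pos s.kind ((x :: ms).getD k []) ((x :: ms).getD (k + 1) []) := by
  induction w generalizing x ms k with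
  | nil => simp at hk
  | cons t w ih =>
    obtain ⟨m, ms', rfl, h1, h2⟩ := h
    cases k with
    | zero =>
      simp only [List.getElem?_cons_zero, Option.some.injEq] at hk
      subst hk
      simpa using h1
    | succ k => simpa using ih h2 (by simpa using hk)

theorem LocalRel.append {k : Kind} {x y : List H} (h : LocalRel k x y) (q : List H) :
    LocalRel k (x ++ q) (y ++ q) := by
  match k, h with
  | .cup, ⟨a, h⟩ => subst h; exact ⟨a, rfl⟩
  | .cap, ⟨a, h⟩ => subst h; exact ⟨a, rfl⟩
  | .crossing true, ⟨a, b, r, h, h'⟩ => subst h h'; exact ⟨a, b, r ++ q, rfl, rfl⟩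
  | .crossing false, ⟨a, b, r, h, h'⟩ => subst h h'; exact ⟨a, b, r ++ q, rfl, rfl⟩

theorem map_range_add {α : Type*} (f : ℕ → α) (m n : ℕ) :
    (List.range (m + n)).map f = (List.range m).map f ++ (List.range n).map fun j => f (m + j) := by
  rw [List.range_add, List.map_append, List.map_map]
  rfl

theorem sliceRel_map_range {f g : ℕ → H} {i r : ℕ} {k : Kind} (hl : ∀ j < i, f j = g j)
    (hr : ∀ d < r, f (i + k.bottom + d) = g (i + k.top + d))
    (h : LocalRel k ((List.range k.bottom).map fun j => f (i + j))
      ((List.range k.top).map fun j => g (i + j))) :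
    SliceRel i k ((List.range (i + k.bottom + r)).map f) ((List.range (i + k.top + r)).map g) := by
  have h1 : (List.range i).map f = (List.range i).map g :=
    List.map_congr_left fun j hj => hl j (List.mem_range.1 hj)
  have h2 : (List.range r).map (fun j => f (i + k.bottom + j)) =
      (List.range r).map fun j => g (i + k.top + j) :=
    List.map_congr_left fun j hj => hr j (List.mem_range.1 hj)
  rw [map_range_add, map_range_add f, map_range_add g, map_range_add g, h1, h2]
  rw [List.append_assoc, List.append_assoc]
  refine (sliceRel_append_left (j := 0) (by simp)).2 ⟨_, rfl, h.append _⟩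

/-- The equation to the right holds for every `d`: beyond the last strand both sides are the default
`1`, since the lengths differ exactly by the change in endpoints. -/
theorem SliceRel.getD {i : ℕ} {k : Kind} {x y : List H} (h : SliceRel i k x y) :
    (∀ j < i, x.getD j 1 = y.getD j 1) ∧
      (∀ d, x.getD (i + k.bottom + d) 1 = y.getD (i + k.top + d) 1) ∧
        LocalRel k (x.drop i) (y.drop i) := by
  induction i generalizing x y with
  | zero =>
    refine ⟨by simp, fun d => ?_, h⟩
    match k, h with
    | .cup, ⟨a, h⟩ => subst h; simp [Kind.bottom, Kind.top, show 2 + d = d + 1 + 1 by omega]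
    | .cap, ⟨a, h⟩ => subst h; simp [Kind.bottom, Kind.top, show 2 + d = d + 1 + 1 by omega]
    | .crossing true, ⟨a, b, q, h, h'⟩ =>
      subst h h'; simp [Kind.bottom, Kind.top, show 2 + d = d + 1 + 1 by omega]
    | .crossing false, ⟨a, b, q, h, h'⟩ =>
      subst h h'; simp [Kind.bottom, Kind.top, show 2 + d = d + 1 + 1 by omega]
  | succ i ih =>
    obtain ⟨c, x, y, rfl, rfl, h⟩ := h
    obtain ⟨h1, h2, h3⟩ := ih h
    refine ⟨fun j hj => ?_, fun d => ?_, by simpa using h3⟩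
    · cases j with
      | zero => simp
      | succ j => simpa using h1 j (by omega)
    · have e1 : i + 1 + k.bottom + d = i + k.bottom + d + 1 := by omega
      have e2 : i + 1 + k.top + d = i + k.top + d + 1 := by omega
      rw [e1, e2]
      simpa using h2 d

theorem getD_drop {x : List H} (i j : ℕ) : (x.drop i).getD j 1 = x.getD (i + j) 1 := by
  simp [List.getD_eq_getElem?_getD, List.getElem?_drop]

theorem getD_map (φ : G →* H) (x : List G) (j : ℕ) : (x.map φ).getD j 1 = φ (x.getD j 1) := by
  rw [← map_one φ, List.getD_map]

theorem level_map (φ : G →* H) (ms : List (List G)) (k : ℕ) :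
    level (ms.map (List.map φ)) k = (level ms k).map φ := by
  change (List.map (List.map φ) ([] :: ms)).getD k (List.map φ []) = _
  rw [List.getD_map]
  rfl

theorem Colors.getD_length {w : List Slice} {x y : List H} {ms : List (List H)}
    (h : Colors w x ms y) : (x :: ms).getD ms.length [] = y := by
  induction w generalizing x ms with
  | nil => obtain ⟨rfl, rfl⟩ := h; rfl
  | cons s w ih =>
    obtain ⟨m, ms', rfl, -, h⟩ := h
    simpa using ih h

theorem Colors.level_append {w : List Slice} {z : List H} {m₁ : List (List H)}
    (h : Colors w [] m₁ z) (m₂ : List (List H)) : level (m₁ ++ m₂) w.length = z := by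
  rw [level, ← List.cons_append, List.getD_append _ _ _ _ (by simp [h.length]), ← h.length,
    h.getD_length]

theorem Colors.level_length {w : List Slice} {ms : List (List H)} {y : List H}
    (h : Colors w [] ms y) {k : ℕ} (hk : k ≤ w.length) :
    width (w.take k) 0 = some (level ms k).length := by
  have hw := h
  rw [← List.take_append_drop k w, colors_append] at hw
  obtain ⟨m₁, m₂, z, rfl, h1, h2⟩ := hw
  have hz := h1.level_append m₂
  rw [List.length_take, min_eq_left hk] at hz
  rw [hz]
  exact h1.conn.width

end Universal

/-! ### The coloring of a diagram by its core group -/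

section CoreColors

variable {H : Type*} [Group H]

theorem LinkDiagram.exists_width_take (D : LinkDiagram) (k : ℕ) :
    ∃ n, width (D.word.take k) 0 = some n := by
  have h := D.closed
  rw [← List.take_append_drop k D.word, width_append] at h
  cases hw : width (D.word.take k) 0 with
  | none => rw [hw] at h; simp at h
  | some n => exact ⟨n, rfl⟩

/-- The number of strands at the `k`th horizontal line. -/
def LinkDiagram.levelWidth (D : LinkDiagram) (k : ℕ) : ℕ := (width (D.word.take k) 0).getD 0

theorem LinkDiagram.width_take (D : LinkDiagram) (k : ℕ) :
    width (D.word.take k) 0 = some (D.levelWidth k) := by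
  obtain ⟨n, hn⟩ := D.exists_width_take k
  simp [levelWidth, hn]

theorem LinkDiagram.width_take_succ (D : LinkDiagram) {k : ℕ} {s : Slice}
    (hs : D.word[k]? = some s) :
    ∃ r, D.levelWidth k = s.pos + s.kind.bottom + r ∧
      D.levelWidth (k + 1) = s.pos + s.kind.top + r := by
  have h := D.width_take (k + 1)
  rw [List.take_add_one, hs, width_append, D.width_take k] at h
  simp only [Option.toList_some, Option.bind_some, width_cons_eq_some] at h
  obtain ⟨h1, h2⟩ := h
  simp only [width, Option.some.injEq] at h2
  exact ⟨D.levelWidth k - s.pos - s.kind.bottom, by omega, by omega⟩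

theorem LinkDiagram.valid_iff (D : LinkDiagram) {k j : ℕ} :
    (∃ n, width (D.word.take k) 0 = some n ∧ j < n) ↔ j < D.levelWidth k := by
  simp [D.width_take k]

theorem Strand.lt_levelWidth {D : LinkDiagram} (p : Strand D) : p.pos < D.levelWidth p.level :=
  D.valid_iff.1 p.valid

theorem Strand.level_le {D : LinkDiagram} (p : Strand D) : p.level ≤ D.word.length := by
  by_contra h
  have h1 := p.valid
  rw [List.take_of_length_le (by omega), D.closed] at h1
  simp at h1

/-- The class of the `j`th strand at the `k`th horizontal line, if there is one. -/
def coreColor (D : LinkDiagram) (k j : ℕ) : CoreGroup D :=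
  open Classical in
  if h : ∃ n, width (D.word.take k) 0 = some n ∧ j < n then arc ⟨k, j, h⟩ else 1

theorem coreColor_eq {D : LinkDiagram} {k j : ℕ} (h : j < D.levelWidth k) :
    coreColor D k j = arc ⟨k, j, D.valid_iff.2 h⟩ := dif_pos _

theorem arc_eq_arc {D : LinkDiagram} {p q : Strand D}
    (h : CoreRelator D (FreeGroup.of p * (FreeGroup.of q)⁻¹)) : arc p = arc q := by
  have := PresentedGroup.one_of_mem (rels := {r | CoreRelator D r}) h
  rw [map_mul, map_inv, mul_inv_eq_one] at this
  exact this

theorem arc_eq_core {D : LinkDiagram} {a b c : Strand D}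
    (h : CoreRelator D (FreeGroup.of c *
      (FreeGroup.of a * (FreeGroup.of b)⁻¹ * FreeGroup.of a)⁻¹)) :
    arc c = arc a * (arc b)⁻¹ * arc a := by
  have := PresentedGroup.one_of_mem (rels := {r | CoreRelator D r}) h
  simp only [map_mul, map_inv] at this
  exact mul_inv_eq_one.1 this

/-- The classes of the strands at the `k`th horizontal line. -/
def coreLevel (D : LinkDiagram) (k : ℕ) : List (CoreGroup D) :=
  (List.range (D.levelWidth k)).map (coreColor D k)

theorem sliceRel_coreLevel (D : LinkDiagram) {k : ℕ} {s : Slice} (hs : D.word[k]? = some s) :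
    SliceRel s.pos s.kind (coreLevel D k) (coreLevel D (k + 1)) := by
  obtain ⟨r, h1, h2⟩ := D.width_take_succ hs
  rw [coreLevel, coreLevel, h1, h2]
  apply sliceRel_map_range
  · intro j hj
    rw [coreColor_eq (by omega), coreColor_eq (by omega)]
    exact arc_eq_arc (.through s _ _ hs rfl (.left s j hj))
  · intro d hd
    rw [coreColor_eq (by omega), coreColor_eq (by omega)]
    exact arc_eq_arc (.through s _ _ hs rfl (.right s d))
  · obtain ⟨i, κ⟩ := s
    match κ with
    | .cup =>
      simp only [Kind.bottom, Kind.top] at h1 h2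
      refine ⟨coreColor D (k + 1) i, ?_⟩
      simp only [Kind.bottom, Kind.top, List.range_succ, List.range_zero, List.nil_append,
        List.map_cons, List.map_nil, List.cons_append, add_zero]
      rw [coreColor_eq (by omega), coreColor_eq (by omega)]
      rw [arc_eq_arc (.cup i ⟨k + 1, i, D.valid_iff.2 (by omega)⟩
        ⟨k + 1, i + 1, D.valid_iff.2 (by omega)⟩ k hs ⟨rfl, rfl⟩ ⟨rfl, rfl⟩)]
    | .cap =>
      simp only [Kind.bottom, Kind.top] at h1 h2
      refine ⟨coreColor D k i, ?_⟩
      simp only [Kind.bottom, Kind.top, List.range_succ, List.range_zero, List.nil_append,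
        List.map_cons, List.map_nil, List.cons_append, add_zero]
      rw [coreColor_eq (by omega), coreColor_eq (by omega)]
      rw [arc_eq_arc (.cap i ⟨k, i, D.valid_iff.2 (by omega)⟩
        ⟨k, i + 1, D.valid_iff.2 (by omega)⟩ k hs ⟨rfl, rfl⟩ ⟨rfl, rfl⟩)]
    | .crossing true =>
      simp only [Kind.bottom, Kind.top] at h1 h2
      refine ⟨coreColor D k i, coreColor D k (i + 1), [], ?_, ?_⟩ <;>
      simp only [Kind.bottom, Kind.top, List.range_succ, List.range_zero, List.nil_append,
        List.map_cons, List.map_nil, List.cons_append, add_zero]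
      rw [coreColor_eq (by omega), coreColor_eq (by omega), coreColor_eq (by omega),
        coreColor_eq (by omega)]
      rw [← arc_eq_core (.crossing_true i ⟨k, i, D.valid_iff.2 (by omega)⟩
          ⟨k, i + 1, D.valid_iff.2 (by omega)⟩ ⟨k + 1, i, D.valid_iff.2 (by omega)⟩ k hs
          ⟨rfl, rfl⟩ ⟨rfl, rfl⟩ ⟨rfl, rfl⟩),
        arc_eq_arc (.through _ ⟨k, i, D.valid_iff.2 (by omega)⟩
          ⟨k + 1, i + 1, D.valid_iff.2 (by omega)⟩ hs rfl (.over_true i))]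
    | .crossing false =>
      simp only [Kind.bottom, Kind.top] at h1 h2
      refine ⟨coreColor D k (i + 1), coreColor D k i, [], ?_, ?_⟩ <;>
      simp only [Kind.bottom, Kind.top, List.range_succ, List.range_zero, List.nil_append,
        List.map_cons, List.map_nil, List.cons_append, add_zero]
      rw [coreColor_eq (by omega), coreColor_eq (by omega), coreColor_eq (by omega),
        coreColor_eq (by omega)]
      rw [← arc_eq_core (.crossing_false i ⟨k, i + 1, D.valid_iff.2 (by omega)⟩
          ⟨k, i, D.valid_iff.2 (by omega)⟩ ⟨k + 1, i + 1, D.valid_iff.2 (by omega)⟩ k hs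
          ⟨rfl, rfl⟩ ⟨rfl, rfl⟩ ⟨rfl, rfl⟩),
        arc_eq_arc (.through _ ⟨k, i + 1, D.valid_iff.2 (by omega)⟩
          ⟨k + 1, i, D.valid_iff.2 (by omega)⟩ hs rfl (.over_false i))]

end CoreColors

/-! ### Homomorphisms from core groups as colorings -/

section HomsAndColorings

variable {H : Type*} [Group H] {D E : LinkDiagram} {n : ℕ}

/-- A coloring of a diagram by a group defines a homomorphism from the core group. -/
theorem exists_coreHom {ms : List (List H)} (h : Colors D.word [] ms []) :
    ∃ φ : CoreGroup D →* H, ∀ p : Strand D, φ (arc p) = (level ms p.level).getD p.pos 1 := by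
  have key : ∀ {k s}, D.word[k]? = some s →
      SliceRel s.pos s.kind (level ms k) (level ms (k + 1)) := fun hs => h.sliceRel hs
  refine ⟨PresentedGroup.toGroup (f := fun p : Strand D => (level ms p.level).getD p.pos 1) ?_,
    fun p => PresentedGroup.toGroup.of _⟩
  intro r hr
  cases hr with
  | through s p q hs hq ht =>
    obtain ⟨h1, h2, h3⟩ := (key hs).getD
    simp only [map_mul, map_inv, FreeGroup.lift_apply_of, mul_inv_eq_one, hq]
    generalize p.pos = i at *
    generalize q.pos = j at *
    cases ht with
    | left _ _ hi => exact h1 _ hi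
    | right _ d => exact h2 d
    | over_true =>
      obtain ⟨a, b, q, h4, h5⟩ := h3
      have e := getD_drop (x := level ms p.level) i 0
      have e' := getD_drop (x := level ms (p.level + 1)) i 1
      simp only [cross] at h4 h5
      rw [h4] at e
      rw [h5] at e'
      simpa using e.symm.trans e'
    | over_false =>
      obtain ⟨a, b, q, h4, h5⟩ := h3
      have e := getD_drop (x := level ms p.level) j 1
      have e' := getD_drop (x := level ms (p.level + 1)) j 0
      simp only [cross] at h4 h5
      rw [h4] at e
      rw [h5] at e'
      simpa using e.symm.trans e'
  | cup i p q k hs hp hq =>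
    obtain ⟨a, h4⟩ := (key hs).getD.2.2
    have e := getD_drop (x := level ms (k + 1)) i 0
    have e' := getD_drop (x := level ms (k + 1)) i 1
    simp only [LinkDiag.cup] at h4
    rw [h4] at e e'
    simpa [mul_inv_eq_one, hp, hq] using e.symm.trans e'
  | cap i p q k hs hp hq =>
    obtain ⟨a, h4⟩ := (key hs).getD.2.2
    have e := getD_drop (x := level ms k) i 0
    have e' := getD_drop (x := level ms k) i 1
    simp only [LinkDiag.cap] at h4
    rw [h4] at e e'
    simpa [mul_inv_eq_one, hp, hq] using e.symm.trans e'
  | crossing_true i a b c k hs ha hb hc =>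
    obtain ⟨x, y, q, h4, h5⟩ := (key hs).getD.2.2
    have e1 := getD_drop (x := level ms k) i 0
    have e2 := getD_drop (x := level ms k) i 1
    have e3 := getD_drop (x := level ms (k + 1)) i 0
    simp only [cross] at h4 h5
    rw [h4] at e1 e2
    rw [h5] at e3
    simp only [map_mul, map_inv, FreeGroup.lift_apply_of, mul_inv_eq_one, ha, hb, hc]
    simp at e1 e2 e3 ⊢
    rw [← e1, ← e2, ← e3]
  | crossing_false i a b c k hs ha hb hc =>
    obtain ⟨x, y, q, h4, h5⟩ := (key hs).getD.2.2
    have e1 := getD_drop (x := level ms k) i 0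
    have e2 := getD_drop (x := level ms k) i 1
    have e3 := getD_drop (x := level ms (k + 1)) i 1
    simp only [cross] at h4 h5
    rw [h4] at e1 e2
    rw [h5] at e3
    simp only [map_mul, map_inv, FreeGroup.lift_apply_of, mul_inv_eq_one, ha, hb, hc]
    simp at e1 e2 e3 ⊢
    rw [← e1, ← e2, ← e3]

/-- A coloring of a diagram is determined by the colors of the strands. -/
theorem Colors.ext {ms ms' : List (List H)} (h : Colors D.word [] ms [])
    (h' : Colors D.word [] ms' [])
    (he : ∀ p : Strand D, (level ms p.level).getD p.pos 1 = (level ms' p.level).getD p.pos 1) :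
    ms = ms' := by
  have hl : ∀ k ≤ D.word.length, level ms k = level ms' k := by
    intro k hk
    have e1 := h.level_length hk
    have e2 := h'.level_length hk
    have e3 : (level ms k).length = (level ms' k).length := by
      rw [e1, Option.some.injEq] at e2; exact e2
    refine List.ext_getElem e3 fun j h1 h2 => ?_
    have := he ⟨k, j, _, e1, h1⟩
    rwa [List.getD_eq_getElem _ _ h1, List.getD_eq_getElem _ _ h2] at this
  refine List.ext_getElem (h.length.trans h'.length.symm) fun k h1 h2 => ?_
  have := hl (k + 1) (by have := h.length; omega)
  rwa [level, level, List.getD_cons_succ, List.getD_cons_succ, List.getD_eq_getElem _ _ h1,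
    List.getD_eq_getElem _ _ h2] at this

/-- The coloring of a diagram by its core group. -/
def coreColors (D : LinkDiagram) : List (List (CoreGroup D)) :=
  (List.range D.word.length).map fun k => coreLevel D (k + 1)

theorem colors_coreColors (D : LinkDiagram) : Colors D.word [] (coreColors D) [] := by
  have h := colors_of_levels (coreLevel D) (w := D.word) fun k s hs => sliceRel_coreLevel D hs
  have h0 : coreLevel D 0 = [] := by simp [coreLevel, LinkDiagram.levelWidth, width]
  have h1 : coreLevel D D.word.length = [] := by
    simp [coreLevel, LinkDiagram.levelWidth, D.closed]
  rwa [h0, h1] at h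

theorem level_coreColors {k : ℕ} (hk : k ≤ D.word.length) :
    level (coreColors D) k = coreLevel D k := by
  cases k with
  | zero => simp [level, coreLevel, LinkDiagram.levelWidth, width]
  | succ k =>
    rw [level, List.getD_cons_succ, coreColors, List.getD_eq_getElem _ _ (by simpa using hk)]
    simp

theorem level_coreColors_getD (p : Strand D) :
    (level (coreColors D) p.level).getD p.pos 1 = arc p := by
  rw [level_coreColors p.level_le, coreLevel,
    List.getD_eq_getElem _ _ (by simpa using p.lt_levelWidth)]
  simp only [List.getElem_map, List.getElem_range]
  exact coreColor_eq p.lt_levelWidth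

/-- The class of an arc in the unreduced Burnside group. -/
def burnsideArc (n : ℕ) (p : Strand D) : CoreBurnside n D := QuotientGroup.mk (arc p)

/-- The coloring of a diagram by its unreduced Burnside group. -/
def burnsideColors (n : ℕ) (D : LinkDiagram) : List (List (CoreBurnside n D)) :=
  (coreColors D).map (List.map (QuotientGroup.mk' _))

theorem colors_burnsideColors (n : ℕ) (D : LinkDiagram) :
    Colors D.word [] (burnsideColors n D) [] :=
  (colors_coreColors D).map _

theorem level_burnsideColors_getD (n : ℕ) (p : Strand D) :
    (level (burnsideColors n D) p.level).getD p.pos 1 = burnsideArc n p := by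
  rw [burnsideColors, level_map, getD_map, level_coreColors_getD]
  rfl

theorem level_map_burnsideColors_getD (φ : CoreBurnside n D →* H) (p : Strand D) :
    (level ((burnsideColors n D).map (List.map φ)) p.level).getD p.pos 1 =
      φ (burnsideArc n p) := by
  rw [level_map, getD_map, level_burnsideColors_getD]

theorem coreGroup_hom_ext {φ ψ : CoreGroup D →* H} (h : ∀ p : Strand D, φ (arc p) = ψ (arc p)) :
    φ = ψ := PresentedGroup.ext h

theorem coreBurnside_hom_ext {φ ψ : CoreBurnside n D →* H}
    (h : ∀ p : Strand D, φ (burnsideArc n p) = ψ (burnsideArc n p)) : φ = ψ :=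
  QuotientGroup.monoidHom_ext _ (coreGroup_hom_ext h)

theorem coreBurnside_hom_ext_colors {φ ψ : CoreBurnside n D →* H}
    (h : (burnsideColors n D).map (List.map φ) = (burnsideColors n D).map (List.map ψ)) :
    φ = ψ :=
  coreBurnside_hom_ext fun p => by
    rw [← level_map_burnsideColors_getD, h, level_map_burnsideColors_getD]

theorem exists_coreBurnside_hom (hH : ∀ h : H, h ^ n = 1) {ms : List (List H)}
    (h : Colors D.word [] ms []) :
    ∃ φ : CoreBurnside n D →* H, (burnsideColors n D).map (List.map φ) = ms := by
  obtain ⟨φ, hφ⟩ := exists_coreHom h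
  refine ⟨BurnsideQuotient.lift hH φ, ?_⟩
  refine Colors.ext ((colors_burnsideColors n D).map _) h fun p => ?_
  rw [level_map_burnsideColors_getD, ← hφ]
  rfl

end HomsAndColorings

/-! ### Invariance of the unreduced Burnside group -/

section Transfer

variable {G H : Type*} [Group G] [Group H] {n : ℕ} {u l r v : List Slice}

/-- Colorings of `u ++ l ++ v` and `u ++ r ++ v` that agree outside `l` and `r`. -/
def Transfer (u l r v : List Slice) (ms ms' : List (List H)) : Prop :=
  ∃ m₁ m₂ m₂' m₃ x y, ms = m₁ ++ m₂ ++ m₃ ∧ ms' = m₁ ++ m₂' ++ m₃ ∧ Colors u [] m₁ x ∧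
    Colors l x m₂ y ∧ Colors r x m₂' y ∧ Colors v y m₃ []

theorem Transfer.symm {ms ms' : List (List H)} (h : Transfer u l r v ms ms') :
    Transfer u r l v ms' ms := by
  obtain ⟨m₁, m₂, m₂', m₃, x, y, h1, h2, h3, h4, h5, h6⟩ := h
  exact ⟨m₁, m₂', m₂, m₃, x, y, h2, h1, h3, h5, h4, h6⟩

theorem Transfer.map (φ : G →* H) {ms ms' : List (List G)} (h : Transfer u l r v ms ms') :
    Transfer u l r v (ms.map (List.map φ)) (ms'.map (List.map φ)) := by
  obtain ⟨m₁, m₂, m₂', m₃, x, y, rfl, rfl, h3, h4, h5, h6⟩ := h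
  exact ⟨_, _, _, _, _, _, by simp, by simp, h3.map φ, h4.map φ, h5.map φ, h6.map φ⟩

theorem Transfer.colors {ms ms' : List (List H)} (h : Transfer u l r v ms ms') :
    Colors (u ++ l ++ v) [] ms [] := by
  obtain ⟨m₁, m₂, m₂', m₃, x, y, rfl, rfl, h3, h4, h5, h6⟩ := h
  exact colors_append.2 ⟨_, _, y, rfl, colors_append.2 ⟨_, _, x, rfl, h3, h4⟩, h6⟩

theorem Colors.top_unique {w : List Slice} {x y y' : List H} {ms : List (List H)}
    (h : Colors w x ms y) (h' : Colors w x ms y') : y = y' := by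
  rw [← h.getD_length, ← h'.getD_length]

/-- A coloring has one entry per slice, so the lengths of `u`, `l` and `v` fix how it is cut. Only
the part inside `r` remains, and `hr` determines it from its boundary. -/
theorem Transfer.unique (hr : ∀ {x y : List H} {m m' : List (List H)},
    Colors r x m y → Colors r x m' y → m = m') {ms ms' ms'' : List (List H)}
    (h : Transfer u l r v ms ms') (h' : Transfer u l r v ms ms'') : ms' = ms'' := by
  obtain ⟨m₁, m₂, m₂', m₃, x, y, rfl, rfl, h3, h4, h5, h6⟩ := h
  obtain ⟨n₁, n₂, n₂', n₃, z, t, h1', rfl, h3', h4', h5', h6'⟩ := h'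
  obtain ⟨e1, rfl⟩ := List.append_inj h1' (by
    simp [h3.length, h4.length, h3'.length, h4'.length])
  obtain ⟨rfl, rfl⟩ := List.append_inj e1 (by simp [h3.length, h3'.length])
  obtain rfl := h3.top_unique h3'
  obtain rfl := h4.top_unique h4'
  rw [hr h5 h5']

theorem exists_transfer (hlr : ∀ {x y : List H}, Conn (H := H) u [] x → Conn l x y → Conn r x y)
    {ms : List (List H)} (h : Colors (u ++ l ++ v) [] ms []) :
    ∃ ms', Transfer u l r v ms ms' := by
  obtain ⟨m, m₃, y, rfl, h1, h6⟩ := colors_append.1 h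
  obtain ⟨m₁, m₂, x, rfl, h3, h4⟩ := colors_append.1 h1
  obtain ⟨m₂', h5⟩ := conn_iff_exists_colors.1 (hlr h3.conn h4.conn)
  exact ⟨_, m₁, m₂, m₂', m₃, x, y, rfl, rfl, h3, h4, h5, h6⟩

theorem width_of_closed {D : LinkDiagram} {w : List Slice} (hD : D.word = u ++ w ++ v)
    {x : List H} (hx : Conn u [] x) : ∃ m, width w x.length = some m := by
  have h := D.closed
  have hw : width u 0 = some x.length := hx.width
  rw [hD, List.append_assoc, width_append, hw, Option.bind_some, width_append] at h
  cases hw : width w x.length with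
  | none => rw [hw] at h; simp at h
  | some m => exact ⟨m, rfl⟩

/-- On the empty line only an exchange of two minima, or a kink at a minimum, has a left side that
fits, and both end with strands. So every move has a strand just below or just above it. -/
theorem Rule.width_pos (hn : n ≠ 0) (h : Rule n l r) {m : ℕ} (hl : width l 0 = some m) :
    0 < m := by
  cases h with
  | isotopy h =>
    cases h with
    | exchange A B i d =>
      cases A <;> cases B <;> simp [width, Kind.bottom, Kind.top] at hl; omega
    | zigzag_left i => simp [width, cup, cap, Kind.bottom, Kind.top] at hl
    | zigzag_right i => simp [width, cup, Kind.bottom] at hl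
    | slide_cap i s => simp [width, cross, Kind.bottom] at hl
    | slide_cup i s => simp [width, cup, Kind.bottom] at hl
    | reidemeister_one_cap i s => simp [width, cross, Kind.bottom] at hl
    | reidemeister_one_cup i s =>
      simp [width, cup, cross, Kind.bottom, Kind.top] at hl; omega
    | reidemeister_two i s => simp [width, cross, Kind.bottom] at hl
    | reidemeister_three i s₁ s₂ s₃ _ => simp [width, cross, Kind.bottom] at hl
  | nMove i s =>
    obtain ⟨k, rfl⟩ := Nat.exists_eq_succ_of_ne_zero hn
    simp [List.replicate_succ, width, cross, Kind.bottom] at hl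

end Transfer

/-! ### The isomorphism induced by one move -/

section StepInvariance

variable {n : ℕ} {D E : LinkDiagram}

/-- A move induces an isomorphism of unreduced Burnside groups, which takes some arc to an arc. -/
theorem Step.exists_equiv (hn : n ≠ 0) (h : Step n D E) :
    ∃ (Φ : CoreBurnside n D ≃* CoreBurnside n E) (p : Strand D) (q : Strand E),
      Φ (burnsideArc n p) = burnsideArc n q := by
  obtain ⟨u, l, r, v, hR, hD, hE⟩ := h
  have hcD := colors_burnsideColors n D
  have hcE := colors_burnsideColors n E
  have hexpD : ∀ a : CoreBurnside n D, a ^ n = 1 := BurnsideQuotient.pow_eq_one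
  have hexpE : ∀ a : CoreBurnside n E, a ^ n = 1 := BurnsideQuotient.pow_eq_one
  -- The universal coloring of `D`, carried across the move, colors `E` by the group of `D`, hence
  -- defines a homomorphism out of the group of `E`; the other direction is symmetric.
  obtain ⟨cE, htE⟩ : ∃ ms', Transfer u l r v (burnsideColors n D) ms' := by
    rw [hD] at hcD
    refine exists_transfer (fun {x y} hx hl => ?_) hcD
    obtain ⟨m, hm⟩ := width_of_closed hD hx
    exact (hR.conn_iff hn hexpD hm).1 hl
  obtain ⟨cD, htD⟩ : ∃ ms', Transfer u r l v (burnsideColors n E) ms' := by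
    rw [hE] at hcE
    refine exists_transfer (fun {x y} hx hl => ?_) hcE
    obtain ⟨m, hm⟩ := width_of_closed hD hx
    exact (hR.conn_iff hn hexpE hm).2 hl
  obtain ⟨f, hf⟩ := exists_coreBurnside_hom (n := n) (D := E) hexpD (hE ▸ htE.symm.colors)
  obtain ⟨g, hg⟩ := exists_coreBurnside_hom (n := n) (D := D) hexpE (hD ▸ htD.symm.colors)
  -- Both the universal coloring of `D` and its image under `f ∘ g` are transfers of the same
  -- coloring `cE`, so they agree.
  have hfg : f.comp g = MonoidHom.id _ := by
    apply coreBurnside_hom_ext_colors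
    have h1 := htD.map f
    rw [← hg, hf] at h1
    have h2 := h1.unique (fun h h' => (hR.colors_unique.1 h h')) htE.symm
    simpa [List.map_map, Function.comp_def] using h2
  have hgf : g.comp f = MonoidHom.id _ := by
    apply coreBurnside_hom_ext_colors
    have h1 := htE.map g
    rw [← hf, hg] at h1
    have h2 := h1.unique (fun h h' => (hR.colors_unique.2 h h')) htD.symm
    simpa [List.map_map, Function.comp_def] using h2
  refine ⟨MonoidHom.toMulEquiv g f hfg hgf, ?_⟩
  obtain ⟨m₁, m₂, m₂', m₃, x, y, e1, e2, h3, h4, h5, h6⟩ := htD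
  have hlevel : ∀ (k k' : ℕ), k' ≤ D.word.length → k ≤ E.word.length →
      level cD k' = level (burnsideColors n E) k → 0 < (level cD k').length →
      ∃ (p : Strand D) (q : Strand E), g (burnsideArc n p) = burnsideArc n q := by
    intro k k' hk' hk he hpos
    have hw' := (hg ▸ (colors_burnsideColors n D).map g : Colors D.word [] cD []).level_length hk'
    have hw := (colors_burnsideColors n E).level_length hk
    refine ⟨⟨k', 0, _, hw', hpos⟩, ⟨k, 0, _, hw, he ▸ hpos⟩, ?_⟩
    rw [← level_map_burnsideColors_getD, hg, ← level_burnsideColors_getD]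
    simp only [he]
  -- The matching arcs are taken on the line just below the move or, if that line is empty, on the
  -- line just above it.
  rcases Nat.eq_zero_or_pos x.length with hx | hx
  · obtain ⟨m, hm⟩ := width_of_closed hD h3.conn
    have hy := h5.conn.width
    rw [hx] at hy
    have hypos : 0 < y.length := hR.width_pos hn hy
    have e3 : level cD (u ++ l).length = y := by
      rw [e2]
      exact (colors_append.2 ⟨_, _, x, rfl, h3, h5⟩ : Colors (u ++ l) [] _ y).level_append _
    have e4 : level (burnsideColors n E) (u ++ r).length = y := by
      rw [e1]
      exact (colors_append.2 ⟨_, _, x, rfl, h3, h4⟩ : Colors (u ++ r) [] _ y).level_append _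
    exact hlevel _ _ (by rw [hD]; simp) (by rw [hE]; simp) (e3.trans e4.symm) (e3 ▸ hypos)
  · have e3 : level cD u.length = x := by
      rw [e2, List.append_assoc]; exact h3.level_append _
    have e4 : level (burnsideColors n E) u.length = x := by
      rw [e1, List.append_assoc]; exact h3.level_append _
    exact hlevel _ _ (by rw [hD]; simp) (by rw [hE]; simp) (e3.trans e4.symm)
      (e3 ▸ hx)

end StepInvariance
/-! ### The reduced Burnside group -/

section Reduced

variable {H : Type*} [Group H] {n : ℕ} {D E : LinkDiagram}

/-- The class of an arc in the Burnside group of a link. -/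
def linkArc (n : ℕ) (e p : Strand D) : LinkBurnside n D e :=
  QuotientGroup.mk (QuotientGroup.mk (arc p))

theorem linkArc_self (n : ℕ) (e : Strand D) : linkArc n e e = 1 := by
  have h : (QuotientGroup.mk (arc e) : DoubleCoverGroup D e) = 1 :=
    (QuotientGroup.eq_one_iff _).2 (Subgroup.subset_normalClosure rfl)
  rw [linkArc, h]
  rfl

theorem linkBurnside_hom_ext {e : Strand D} {φ ψ : LinkBurnside n D e →* H}
    (h : ∀ p : Strand D, φ (linkArc n e p) = ψ (linkArc n e p)) : φ = ψ :=
  QuotientGroup.monoidHom_ext _ (QuotientGroup.monoidHom_ext _ (coreGroup_hom_ext h))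

theorem exists_linkBurnside_hom (hH : ∀ h : H, h ^ n = 1) {e : Strand D}
    (φ : CoreGroup D →* H) (he : φ (arc e) = 1) :
    ∃ ψ : LinkBurnside n D e →* H, ∀ p : Strand D, ψ (linkArc n e p) = φ (arc p) := by
  have h : Subgroup.normalClosure {arc e} ≤ φ.ker :=
    Subgroup.normalClosure_le_normal (by simpa [MonoidHom.mem_ker] using he)
  exact ⟨BurnsideQuotient.lift hH (QuotientGroup.lift _ φ fun x hx => h hx), fun p => rfl⟩

/-- The projection of the unreduced onto the reduced Burnside group. -/
def burnsideProj (n : ℕ) (e : Strand D) : CoreBurnside n D →* LinkBurnside n D e :=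
  BurnsideQuotient.lift BurnsideQuotient.pow_eq_one
    ((QuotientGroup.mk' _).comp (QuotientGroup.mk' _))

@[simp]
theorem burnsideProj_burnsideArc (e p : Strand D) :
    burnsideProj n e (burnsideArc n p) = linkArc n e p := rfl

theorem exists_linkBurnside_hom_of_coreBurnside {e : Strand D} (hH : ∀ h : H, h ^ n = 1)
    (φ : CoreBurnside n D →* H) (he : φ (burnsideArc n e) = 1) :
    ∃ ψ : LinkBurnside n D e →* H, ψ.comp (burnsideProj n e) = φ := by
  obtain ⟨ψ, hψ⟩ := exists_linkBurnside_hom hH (φ.comp (QuotientGroup.mk' _)) he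
  exact ⟨ψ, coreBurnside_hom_ext hψ⟩

theorem burnsideProj_cancel {e : Strand D} {φ ψ : LinkBurnside n D e →* H}
    (h : φ.comp (burnsideProj n e) = ψ.comp (burnsideProj n e)) : φ = ψ :=
  linkBurnside_hom_ext fun p => DFunLike.congr_fun h (burnsideArc n p)

/-- The core relations are invariant under left multiplication. -/
theorem exists_translate (φ : CoreGroup D →* H) (g : H) :
    ∃ ψ : CoreGroup D →* H, ∀ p : Strand D, ψ (arc p) = g * φ (arc p) := by
  refine ⟨PresentedGroup.toGroup (f := fun p : Strand D => g * φ (arc p)) ?_,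
    fun p => PresentedGroup.toGroup.of _⟩
  intro r hr
  have h1 : ∀ {p q : Strand D}, CoreRelator D (FreeGroup.of p * (FreeGroup.of q)⁻¹) →
      FreeGroup.lift (fun p : Strand D => g * φ (arc p))
        (FreeGroup.of p * (FreeGroup.of q)⁻¹) = 1 := by
    intro p q h
    simp [arc_eq_arc h]
  have h2 : ∀ {a b c : Strand D}, CoreRelator D (FreeGroup.of c *
      (FreeGroup.of a * (FreeGroup.of b)⁻¹ * FreeGroup.of a)⁻¹) →
      FreeGroup.lift (fun p : Strand D => g * φ (arc p)) (FreeGroup.of c *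
      (FreeGroup.of a * (FreeGroup.of b)⁻¹ * FreeGroup.of a)⁻¹) = 1 := by
    intro a b c h
    simp [arc_eq_core h, mul_assoc]
  cases hr with
  | through s p q hs hq ht => exact h1 (.through s p q hs hq ht)
  | cup i p q k hs hp hq => exact h1 (.cup i p q k hs hp hq)
  | cap i p q k hs hp hq => exact h1 (.cap i p q k hs hp hq)
  | crossing_true i a b c k hs ha hb hc => exact h2 (.crossing_true i a b c k hs ha hb hc)
  | crossing_false i a b c k hs ha hb hc => exact h2 (.crossing_false i a b c k hs ha hb hc)

/-- Left translation by the inverse of the class of `d` sends `d` to `1`, as the normalization at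
`d` requires. -/
theorem exists_linkBurnside_change (d e : Strand D) :
    ∃ f : LinkBurnside n D d →* LinkBurnside n D e,
      ∀ p, f (linkArc n d p) = (linkArc n e d)⁻¹ * linkArc n e p := by
  obtain ⟨φ, hφ⟩ := exists_translate
    ((QuotientGroup.mk' _ : DoubleCoverGroup D e →* LinkBurnside n D e).comp
      (QuotientGroup.mk' _)) (linkArc n e d)⁻¹
  have hφ' : ∀ p, φ (arc p) = (linkArc n e d)⁻¹ * linkArc n e p := hφ
  obtain ⟨f, hf⟩ := exists_linkBurnside_hom (n := n) (e := d) BurnsideQuotient.pow_eq_one φ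
    (by rw [hφ', inv_mul_cancel])
  exact ⟨f, fun p => (hf p).trans (hφ' p)⟩

/-- The Burnside group of a link does not depend on the arc put equal to `1`. -/
theorem nonempty_linkBurnside_equiv (n : ℕ) (d e : Strand D) :
    Nonempty (LinkBurnside n D d ≃* LinkBurnside n D e) := by
  have key : ∀ {d e : Strand D} {f : LinkBurnside n D d →* LinkBurnside n D e}
      {g : LinkBurnside n D e →* LinkBurnside n D d},
      (∀ p, f (linkArc n d p) = (linkArc n e d)⁻¹ * linkArc n e p) →
      (∀ p, g (linkArc n e p) = (linkArc n d e)⁻¹ * linkArc n d p) →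
      g.comp f = MonoidHom.id _ := by
    intro d e f g hf hg
    apply linkBurnside_hom_ext
    intro p
    simp [hf, hg, linkArc_self]
  obtain ⟨f, hf⟩ := exists_linkBurnside_change (n := n) d e
  obtain ⟨g, hg⟩ := exists_linkBurnside_change (n := n) e d
  exact ⟨MonoidHom.toMulEquiv f g (key hf hg) (key hg hf)⟩

theorem nonempty_linkBurnside_equiv_of_equiv (Φ : CoreBurnside n D ≃* CoreBurnside n E)
    {p : Strand D} {q : Strand E} (h : Φ (burnsideArc n p) = burnsideArc n q) :
    Nonempty (LinkBurnside n D p ≃* LinkBurnside n E q) := by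
  obtain ⟨f, hf⟩ := exists_linkBurnside_hom_of_coreBurnside (e := p) (H := LinkBurnside n E q)
    BurnsideQuotient.pow_eq_one ((burnsideProj n q).comp Φ.toMonoidHom)
    (by simp [h, linkArc_self])
  obtain ⟨g, hg⟩ := exists_linkBurnside_hom_of_coreBurnside (e := q) (H := LinkBurnside n D p)
    BurnsideQuotient.pow_eq_one ((burnsideProj n p).comp Φ.symm.toMonoidHom)
    (by simp [← h, linkArc_self])
  refine ⟨MonoidHom.toMulEquiv f g (burnsideProj_cancel ?_) (burnsideProj_cancel ?_)⟩
  · rw [MonoidHom.comp_assoc, hf, ← MonoidHom.comp_assoc, hg]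
    ext x
    simp
  · rw [MonoidHom.comp_assoc, hg, ← MonoidHom.comp_assoc, hf]
    ext x
    simp

/-- The Burnside groups are invariant under `n`-moves. -/
theorem MoveEquiv.burnside_equiv (hn : n ≠ 0) (h : MoveEquiv n D E) :
    Nonempty (CoreBurnside n D ≃* CoreBurnside n E) ∧
      (∀ (d : Strand D) (e : Strand E), Nonempty (LinkBurnside n D d ≃* LinkBurnside n E e)) ∧
      (Nonempty (Strand D) ↔ Nonempty (Strand E)) := by
  induction h with
  | rel D E h =>
    obtain ⟨Φ, p, q, hpq⟩ := h.exists_equiv hn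
    refine ⟨⟨Φ⟩, fun d e => ?_, fun _ => ⟨q⟩, fun _ => ⟨p⟩⟩
    obtain ⟨f⟩ := nonempty_linkBurnside_equiv_of_equiv Φ hpq
    obtain ⟨f₁⟩ := nonempty_linkBurnside_equiv n d p
    obtain ⟨f₂⟩ := nonempty_linkBurnside_equiv n q e
    exact ⟨(f₁.trans f).trans f₂⟩
  | refl D => exact ⟨⟨MulEquiv.refl _⟩, nonempty_linkBurnside_equiv n, Iff.rfl⟩
  | symm D E _ ih =>
    obtain ⟨⟨f⟩, h, hs⟩ := ih
    exact ⟨⟨f.symm⟩, fun e d => (h d e).map MulEquiv.symm, hs.symm⟩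
  | trans D E F _ _ ih₁ ih₂ =>
    obtain ⟨⟨f⟩, h, hs⟩ := ih₁
    obtain ⟨⟨g⟩, h', hs'⟩ := ih₂
    refine ⟨⟨f.trans g⟩, fun d e => ?_, hs.trans hs'⟩
    -- The reduced groups of `D` and `F` are compared through an arc of `E`; the third conjunct is
    -- carried along to provide one.
    obtain ⟨m⟩ := hs.1 ⟨d⟩
    obtain ⟨a⟩ := h d m
    obtain ⟨b⟩ := h' m e
    exact ⟨a.trans b⟩

/-! ### Counting homomorphisms -/

/-- Homomorphisms from the unreduced Burnside group correspond to colorings. -/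
theorem card_coreBurnside_hom (hH : ∀ h : H, h ^ n = 1) :
    Nat.card (CoreBurnside n D →* H) =
      Nat.card {ms : List (List H) // Colors D.word [] ms []} := by
  refine Nat.card_congr (Equiv.ofBijective
    (fun φ => ⟨(burnsideColors n D).map (List.map φ), (colors_burnsideColors n D).map φ⟩)
    ⟨fun φ ψ h => coreBurnside_hom_ext_colors (congrArg Subtype.val h), fun ms => ?_⟩)
  obtain ⟨φ, hφ⟩ := exists_coreBurnside_hom hH ms.2
  exact ⟨φ, Subtype.ext hφ⟩

theorem exists_burnside_translate (hH : ∀ h : H, h ^ n = 1) (φ : CoreBurnside n D →* H) (g : H) :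
    ∃ ψ : CoreBurnside n D →* H, ∀ p, ψ (burnsideArc n p) = g * φ (burnsideArc n p) := by
  obtain ⟨ψ, hψ⟩ := exists_translate (φ.comp (QuotientGroup.mk' _)) g
  exact ⟨BurnsideQuotient.lift hH ψ, hψ⟩

/-- A homomorphism amounts to its value at `e`, which is arbitrary, and its left translate sending
`e` to `1`, which factors through the reduced group. -/
theorem card_coreBurnside_hom_eq_mul (hH : ∀ h : H, h ^ n = 1) (e : Strand D) :
    Nat.card (CoreBurnside n D →* H) = Nat.card H * Nat.card (LinkBurnside n D e →* H) := by
  rw [← Nat.card_prod]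
  choose T hT using fun (x : H × (LinkBurnside n D e →* H)) =>
    exists_burnside_translate hH (x.2.comp (burnsideProj n e)) x.1
  refine (Nat.card_congr (Equiv.ofBijective T ⟨fun x y h => ?_, fun φ => ?_⟩)).symm
  · have h1 : ∀ p, x.1 * x.2 (linkArc n e p) = y.1 * y.2 (linkArc n e p) := fun p => by
      have := DFunLike.congr_fun h (burnsideArc n p)
      rwa [hT, hT] at this
    have h2 : x.1 = y.1 := by simpa [linkArc_self] using h1 e
    refine Prod.ext h2 (linkBurnside_hom_ext fun p => ?_)
    have := h1 p
    rwa [h2, mul_right_inj] at this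
  · obtain ⟨ψ, hψ⟩ := exists_burnside_translate hH φ (φ (burnsideArc n e))⁻¹
    obtain ⟨χ, hχ⟩ := exists_linkBurnside_hom_of_coreBurnside (e := e) hH ψ (by simp [hψ])
    refine ⟨(φ (burnsideArc n e), χ), coreBurnside_hom_ext fun p => ?_⟩
    rw [hT, hχ, hψ, mul_inv_cancel_left]

end Reduced
/-! ### Moves of closed braids -/

section ClosedBraids

variable {N m : ℕ}

theorem BraidWord.slices_append (u v : BraidWord N) :
    BraidWord.slices (n := N) (u ++ v) = BraidWord.slices u ++ BraidWord.slices v :=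
  List.map_append

theorem step_closure {w w' : BraidWord N} (h : Rule m w.slices w'.slices) (u v : BraidWord N) :
    Step m (BraidWord.closure (u ++ w ++ v)) (BraidWord.closure (u ++ w' ++ v)) :=
  ⟨closingCups N ++ BraidWord.slices u, _, _, BraidWord.slices v ++ closingCaps N, h,
    by simp [BraidWord.closure, BraidWord.slices_append],
    by simp [BraidWord.closure, BraidWord.slices_append]⟩

/-- Braid words are identified if they are interchangeable in closed braids up to `m`-moves. -/
def braidCon (N m : ℕ) : Con (FreeMonoid (Fin (N - 1) × Bool)) where
  r w w' := ∀ u v : BraidWord N, MoveEquiv m (BraidWord.closure (u ++ w.toList ++ v))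
    (BraidWord.closure (u ++ w'.toList ++ v))
  iseqv := ⟨fun _ _ _ => .refl _, fun h u v => .symm _ _ (h u v),
    fun h h' u v => .trans _ _ _ (h u v) (h' u v)⟩
  mul' := by
    intro w x y z h h' u v
    have h1 := h u (y.toList ++ v)
    have h2 := h' (u ++ x.toList) v
    simp only [FreeMonoid.toList_mul, List.append_assoc] at h1 h2 ⊢
    exact .trans _ _ _ h1 h2

/-- The class of a generator of the braid group. -/
def braidGen (N m : ℕ) (x : Fin (N - 1) × Bool) : (braidCon N m).Quotient :=
  (braidCon N m).mk' (FreeMonoid.of x)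

theorem braidCon_mk_ofList (w : BraidWord N) :
    (braidCon N m).mk' (FreeMonoid.ofList w) = (w.map (braidGen N m)).prod := by
  induction w with
  | nil => exact map_one _
  | cons x w ih => rw [FreeMonoid.ofList_cons, map_mul, ih, List.map_cons, List.prod_cons]; rfl

theorem moveEquiv_closure {w w' : BraidWord N}
    (h : (w.map (braidGen N m)).prod = (w'.map (braidGen N m)).prod) :
    MoveEquiv m (BraidWord.closure w) (BraidWord.closure w') := by
  rw [← braidCon_mk_ofList, ← braidCon_mk_ofList] at h
  have := (Con.eq _).1 h [] []
  simpa using this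

/-- A local rule between braid words is one move of the closure in every context, hence a relation
in the quotient monoid. -/
theorem prod_braidGen_eq {w w' : BraidWord N} (h : Rule m w.slices w'.slices) :
    (w.map (braidGen N m)).prod = (w'.map (braidGen N m)).prod := by
  rw [← braidCon_mk_ofList, ← braidCon_mk_ofList]
  exact (Con.eq _).2 fun u v => .rel _ _ (step_closure h u v)

/-- The class of a generator of the braid group, as an invertible element. -/
def braidUnit (N m : ℕ) (i : Fin (N - 1)) : ((braidCon N m).Quotient)ˣ where
  val := braidGen N m (i, true)
  inv := braidGen N m (i, false)
  val_inv := by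
    simpa using prod_braidGen_eq (w := [(i, true), (i, false)]) (w' := [])
      (.isotopy (.reidemeister_two i true))
  inv_val := by
    simpa using prod_braidGen_eq (w := [(i, false), (i, true)]) (w' := [])
      (.isotopy (.reidemeister_two i false))

theorem braidUnit_pow (i : Fin (N - 1)) : braidUnit N m i ^ m = 1 := by
  apply Units.ext
  have := prod_braidGen_eq (N := N) (w := List.replicate m (i, true)) (w' := [])
    (by simpa [BraidWord.slices] using Rule.nMove (n := m) i true)
  simpa [List.map_replicate, braidUnit] using this

theorem braidUnit_braid {i j : Fin (N - 1)} (h : (j : ℕ) = i + 1) :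
    braidUnit N m i * braidUnit N m j * braidUnit N m i =
      braidUnit N m j * braidUnit N m i * braidUnit N m j := by
  apply Units.ext
  have := prod_braidGen_eq (N := N) (m := m) (w := [(i, true), (j, true), (i, true)])
    (w' := [(j, true), (i, true), (j, true)])
    (by simpa [BraidWord.slices, h] using
      Rule.isotopy (IsotopyRule.reidemeister_three i true true true (Or.inl rfl)))
  simpa [braidUnit, mul_assoc] using this

theorem braidUnit_comm {i j : Fin (N - 1)} (h : (i : ℕ) + 2 ≤ j) :
    braidUnit N m i * braidUnit N m j = braidUnit N m j * braidUnit N m i := by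
  apply Units.ext
  obtain ⟨d, hd⟩ := Nat.exists_eq_add_of_le h
  have := prod_braidGen_eq (N := N) (m := m) (w := [(j, true), (i, true)])
    (w' := [(i, true), (j, true)])
    (by simpa [BraidWord.slices, hd, cross, Kind.bottom, Kind.top] using
      Rule.isotopy (n := m) (.exchange (.crossing true) (.crossing true) (i : ℕ) d))
  simpa [braidUnit] using this.symm

/-- Chen's link is `3`-move equivalent to the closure of `Δ₅⁴`. -/
theorem moveEquiv_chenLink : MoveEquiv 3 chenLink deltaFourth.closure := by
  apply moveEquiv_closure
  -- The group identity is applied to the units of the quotient monoid, where the moves provide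
  -- exactly the braid and cubic relations.
  have h := congrArg Units.val (chenBraid_identity
    (braidUnit_pow (N := 5) (m := 3) 0) (braidUnit_pow 1) (braidUnit_pow 2) (braidUnit_pow 3)
    (braidUnit_braid rfl) (braidUnit_braid rfl) (braidUnit_braid rfl)
    (braidUnit_comm (by decide)) (braidUnit_comm (by decide)) (braidUnit_comm (by decide)))
  have hv : ∀ i, (braidUnit 5 3 i : (braidCon 5 3).Quotient) = braidGen 5 3 (i, true) :=
    fun _ => rfl
  have hi : ∀ i, (((braidUnit 5 3 i)⁻¹ : ((braidCon 5 3).Quotient)ˣ) :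
      (braidCon 5 3).Quotient) = braidGen 5 3 (i, false) := fun _ => rfl
  simp only [Units.val_pow_eq_pow_val, Units.val_mul, hv, hi] at h
  rw [chenBraid, deltaFourth, List.map_flatten, List.map_flatten, List.map_replicate,
    List.map_replicate, List.prod_flatten, List.prod_flatten, List.map_replicate,
    List.map_replicate, List.prod_replicate, List.prod_replicate]
  simpa [mul_assoc] using h

end ClosedBraids
/-! ### Colorings of closed braids -/

section ClosedBraidColorings

variable {H : Type*} [Group H] {N : ℕ}

theorem conn_singleton {s : Slice} {x y : List H} :
    Conn [s] x y ↔ SliceRel s.pos s.kind x y := by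
  simp [Conn]

/-- The minima are nested, so the colors at the top form a palindrome whose first half is free. -/
theorem conn_closingCups {n : ℕ} {z : List H} :
    Conn (closingCups n) [] z ↔ ∃ t, t.length = n ∧ z = t ++ t.reverse := by
  induction n generalizing z with
  | zero => simp [closingCups, Conn, eq_comm]
  | succ n ih =>
    rw [closingCups, List.range_succ, List.map_append, conn_append]
    change (∃ m, Conn (closingCups n) [] m ∧ Conn [cup n] m z) ↔ _
    simp only [ih, conn_singleton]
    constructor
    · rintro ⟨_, ⟨t, ht, rfl⟩, h⟩
      obtain ⟨y, rfl, a, rfl⟩ := (sliceRel_append_left (j := 0) ht).1 h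
      exact ⟨t ++ [a], by simp [ht], by simp⟩
    · rintro ⟨t, ht, rfl⟩
      obtain ⟨t, a, rfl⟩ := List.eq_nil_or_concat' t |>.resolve_left (by rintro rfl; simp at ht)
      have ht' : t.length = n := by simpa using ht
      exact ⟨_, ⟨t, ht', rfl⟩, (sliceRel_append_left (j := 0) ht').2 ⟨_, by simp, a, rfl⟩⟩

theorem conn_closingCaps {n : ℕ} {z : List H} :
    Conn (closingCaps n) z [] ↔ ∃ t, t.length = n ∧ z = t ++ t.reverse := by
  induction n generalizing z with
  | zero => simp [closingCaps, Conn]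
  | succ n ih =>
    rw [closingCaps, List.range_succ, List.reverse_append, List.map_append, conn_append]
    change (∃ m, Conn [cap n] z m ∧ Conn (closingCaps n) m []) ↔ _
    simp only [ih, conn_singleton]
    constructor
    · rintro ⟨_, h, t, ht, rfl⟩
      obtain ⟨p, z, rfl, hp⟩ := exists_append_of_le (le_trans (Nat.le_add_right _ _) h.length.1)
      obtain ⟨y, he, a, rfl⟩ := (sliceRel_append_left (j := 0) hp).1 h
      obtain ⟨rfl, rfl⟩ := List.append_inj he (ht.trans hp.symm)
      exact ⟨t ++ [a], by simp [ht], by simp⟩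
    · rintro ⟨t, ht, rfl⟩
      obtain ⟨t, a, rfl⟩ := List.eq_nil_or_concat' t |>.resolve_left (by rintro rfl; simp at ht)
      have ht' : t.length = n := by simpa using ht
      refine ⟨_, ?_, t, ht', rfl⟩
      rw [List.append_assoc]
      exact (sliceRel_append_left (j := 0) ht').2 ⟨_, rfl, a, by simp⟩

theorem sliceRel_append_right {i : ℕ} {s : Bool} {t q y : List H} (h : i + 2 ≤ t.length) :
    SliceRel i (.crossing s) (t ++ q) y ↔ ∃ t', y = t' ++ q ∧ SliceRel i (.crossing s) t t' := by
  induction i generalizing t y with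
  | zero =>
    obtain ⟨a, t, rfl, h⟩ := exists_cons_of_le (show 1 + 1 ≤ t.length by omega)
    obtain ⟨b, t, rfl, -⟩ := exists_cons_of_le (show 0 + 1 ≤ t.length by omega)
    cases s <;> simp [SliceRel, LocalRel]
  | succ i ih =>
    obtain ⟨a, t, rfl, h₀⟩ := exists_cons_of_le (show (i + 2) + 1 ≤ t.length by omega)
    simp only [SliceRel, List.cons_append, List.cons.injEq]
    constructor
    · rintro ⟨_, _, y', ⟨rfl, rfl⟩, rfl, hy⟩
      obtain ⟨t', rfl, ht'⟩ := (ih h₀).1 hy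
      exact ⟨a :: t', rfl, a, t, t', ⟨rfl, rfl⟩, rfl, ht'⟩
    · rintro ⟨_, rfl, _, _, t', ⟨rfl, rfl⟩, rfl, ht'⟩
      exact ⟨a, t ++ q, t' ++ q, ⟨rfl, rfl⟩, rfl, (ih h₀).2 ⟨t', rfl, ht'⟩⟩

theorem conn_slices_append_right {b : BraidWord N} {t q y : List H} (h : t.length = N) :
    Conn b.slices (t ++ q) y ↔ ∃ t', y = t' ++ q ∧ Conn b.slices t t' := by
  induction b generalizing t with
  | nil => simp [BraidWord.slices, Conn, eq_comm]
  | cons x b ih =>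
    have hx : (x.1 : ℕ) + 2 ≤ t.length := by have := x.1.isLt; omega
    change (∃ m, SliceRel (x.1 : ℕ) (.crossing x.2) (t ++ q) m ∧ Conn (BraidWord.slices b) m y) ↔
      ∃ t', y = t' ++ q ∧ ∃ m, SliceRel (x.1 : ℕ) (.crossing x.2) t m ∧
        Conn (BraidWord.slices b) m t'
    have hlen : ∀ {m}, SliceRel (x.1 : ℕ) (.crossing x.2) t m → m.length = N := fun hm => by
      have := hm.length
      simp only [Kind.bottom, Kind.top] at this
      omega
    simp only [sliceRel_append_right hx]
    constructor
    · rintro ⟨_, ⟨m, rfl, hm⟩, hy⟩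
      obtain ⟨t', rfl, ht'⟩ := (ih (hlen hm)).1 hy
      exact ⟨t', rfl, m, hm, ht'⟩
    · rintro ⟨t', rfl, m, hm, ht'⟩
      exact ⟨_, ⟨m, rfl, hm⟩, (ih (hlen hm)).2 ⟨t', rfl, ht'⟩⟩

/-- A coloring of a closed braid restricts to a coloring of the braid with the same colors at the
bottom and at the top. -/
theorem colors_closure {b : BraidWord N} {ms : List (List H)}
    (h : Colors b.closure.word [] ms []) :
    ∃ m₁ m₂ m₃ t, ms = m₁ ++ m₂ ++ m₃ ∧ t.length = N ∧ Conn b.slices t t ∧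
      Colors (closingCups N) [] m₁ (t ++ t.reverse) ∧
      Colors b.slices (t ++ t.reverse) m₂ (t ++ t.reverse) ∧
      Colors (closingCaps N) (t ++ t.reverse) m₃ [] := by
  obtain ⟨m, m₃, y, rfl, h1, h6⟩ := colors_append.1 h
  obtain ⟨m₁, m₂, x, rfl, h3, h4⟩ := colors_append.1 h1
  obtain ⟨t, ht, rfl⟩ := conn_closingCups.1 h3.conn
  obtain ⟨t', ht', rfl⟩ := conn_closingCaps.1 h6.conn
  obtain ⟨t'', he, hc⟩ := (conn_slices_append_right ht).1 h4.conn
  obtain ⟨rfl, he'⟩ := List.append_inj' he (by simp [ht, ht'])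
  obtain rfl := List.reverse_injective he'
  exact ⟨m₁, m₂, m₃, t', rfl, ht, hc, h3, h4, h6⟩

theorem level_closure {m₁ m₂ m₃ : List (List H)} {t : List H}
    (h : Colors (closingCups N) [] m₁ (t ++ t.reverse)) :
    level (m₁ ++ m₂ ++ m₃) N = t ++ t.reverse := by
  have := h.level_append (m₂ ++ m₃)
  rwa [closingCups, List.length_map, List.length_range, ← List.append_assoc] at this

theorem kind_closingCups {n : ℕ} : ∀ s ∈ closingCups n, s.kind ≠ .cap := by
  simp [closingCups, cup]

theorem kind_closingCaps {n : ℕ} : ∀ s ∈ closingCaps n, s.kind ≠ .cup := by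
  simp [closingCaps, cap]

theorem kind_slices {b : BraidWord N} : ∀ s ∈ b.slices, s.kind ≠ .cup := by
  simp only [BraidWord.slices, List.mem_map]
  rintro _ ⟨x, -, rfl⟩
  simp [cross]

/-- Colorings of a closed braid correspond to fixed points of the action of the braid. -/
theorem card_colors_closure (b : BraidWord N) :
    Nat.card {ms : List (List H) // Colors b.closure.word [] ms []} =
      Nat.card {t : List H // t.length = N ∧ Conn b.slices t t} := by
  have key : ∀ ms : {ms : List (List H) // Colors b.closure.word [] ms []},
      ∃ m₁ m₂ m₃ t, ms.1 = m₁ ++ m₂ ++ m₃ ∧ t.length = N ∧ Conn b.slices t t ∧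
      Colors (closingCups N) [] m₁ (t ++ t.reverse) ∧
      Colors b.slices (t ++ t.reverse) m₂ (t ++ t.reverse) ∧
      Colors (closingCaps N) (t ++ t.reverse) m₃ [] := fun ms => colors_closure ms.2
  choose m₁ m₂ m₃ t hms ht hb h1 h2 h3 using key
  refine Nat.card_congr (Equiv.ofBijective (fun ms => ⟨t ms, ht ms, hb ms⟩)
    ⟨fun ms ms' h => ?_, fun ⟨s, hs, hc⟩ => ?_⟩)
  · have he : t ms = t ms' := congrArg Subtype.val h
    apply Subtype.ext
    rw [hms ms, hms ms']
    have g1 := h1 ms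
    have g2 := h2 ms
    have g3 := h3 ms
    rw [he] at g1 g2 g3
    rw [(g1.unique_bottom kind_closingCups (h1 ms')).1, (g2.unique_top kind_slices (h2 ms')).1,
      (g3.unique_top kind_closingCaps (h3 ms')).1]
  · have hc' : Conn b.slices (s ++ s.reverse) (s ++ s.reverse) :=
      (conn_slices_append_right hs).2 ⟨s, rfl, hc⟩
    obtain ⟨n₁, g1⟩ := conn_iff_exists_colors.1 (conn_closingCups.2 ⟨s, hs, rfl⟩)
    obtain ⟨n₂, g2⟩ := conn_iff_exists_colors.1 hc'
    obtain ⟨n₃, g3⟩ := conn_iff_exists_colors.1 (conn_closingCaps.2 ⟨s, hs, rfl⟩)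
    have hm : Colors b.closure.word [] (n₁ ++ n₂ ++ n₃) [] :=
      colors_append.2 ⟨_, _, _, rfl, colors_append.2 ⟨_, _, _, rfl, g1, g2⟩, g3⟩
    refine ⟨⟨_, hm⟩, Subtype.ext ?_⟩
    -- The tuple chosen for this coloring is `s`: both are the first half of the line just above the
    -- minima.
    have e1 := level_closure (m₂ := n₂) (m₃ := n₃) g1
    have e2 := level_closure (m₂ := m₂ ⟨_, hm⟩) (m₃ := m₃ ⟨_, hm⟩) (h1 ⟨_, hm⟩)
    rw [← hms ⟨_, hm⟩, e1] at e2
    exact (List.append_inj_left e2 (hs.trans (ht _).symm)).symm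

end ClosedBraidColorings

/-! ### The action of full twists on colors -/

section DeltaFourth

variable {H : Type*} [Group H]

/-- The first strand passes over the four others to the far right and reflects their colors in its
own. -/
theorem conn_delta (a b c d e : H) (y : List H) :
    Conn (H := H) [cross 0 true, cross 1 true, cross 2 true, cross 3 true] [a, b, c, d, e] y ↔
      y = [a * b⁻¹ * a, a * c⁻¹ * a, a * d⁻¹ * a, a * e⁻¹ * a, a] := by
  simp [Conn, SliceRel, LocalRel, cross, eq_comm]

/-- The alternating product of five elements. -/
def alternating (a b c d e : H) : H := a * b⁻¹ * c * d⁻¹ * e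

theorem conn_full_twist (a b c d e : H) (y : List H) :
    Conn (List.replicate 5 [cross 0 true, cross 1 true, cross 2 true, cross 3 true]).flatten
      [a, b, c, d, e] y ↔
      y = [a, b, c, d, e].map fun x => alternating a b c d e * x⁻¹ * alternating e d c b a := by
  simp only [List.replicate_succ, List.replicate_zero, List.flatten_cons, List.flatten_nil,
    List.append_nil]
  simp only [conn_append, conn_delta, exists_eq_left]
  simp [alternating, mul_assoc]

/-- The full twist `x ↦ α x⁻¹ α'` preserves the alternating product `α` and its reverse `α'`, so its
square is `x ↦ α (α x⁻¹ α')⁻¹ α'`. -/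
theorem conn_deltaFourth (a b c d e : H) (y : List H) :
    Conn deltaFourth.slices [a, b, c, d, e] y ↔
      y = [a, b, c, d, e].map fun x => alternating a b c d e * (alternating e d c b a)⁻¹ * x *
        (alternating a b c d e)⁻¹ * alternating e d c b a := by
  have h : deltaFourth.slices = (List.replicate 5 [cross 0 true, cross 1 true, cross 2 true,
      cross 3 true]).flatten ++ (List.replicate 5 [cross 0 true, cross 1 true, cross 2 true,
      cross 3 true]).flatten := by decide
  rw [h]
  simp only [conn_append, conn_full_twist, exists_eq_left, List.map_cons, List.map_nil]
  have h1 : ∀ p q : H, alternating (p * a⁻¹ * q) (p * b⁻¹ * q) (p * c⁻¹ * q) (p * d⁻¹ * q)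
      (p * e⁻¹ * q) = p * (alternating e d c b a)⁻¹ * q := by
    intro p q
    simp [alternating, mul_assoc]
  have h2 : ∀ p q : H, alternating (p * e⁻¹ * q) (p * d⁻¹ * q) (p * c⁻¹ * q) (p * b⁻¹ * q)
      (p * a⁻¹ * q) = p * (alternating a b c d e)⁻¹ * q := by
    intro p q
    simp [alternating, mul_assoc]
  rw [h1, h2]
  generalize alternating a b c d e = p
  generalize alternating e d c b a = q
  simp [mul_assoc]

/-- With fifth color `1`, the alternating product is `u` and the inverse of the reversed one is `w`.
The fixed-point equation of the fourth strand reads `u w t u⁻¹ w⁻¹ = t`. -/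
theorem wordP_eq_one_of_conn {x y z t : H}
    (h : Conn deltaFourth.slices [x, y, z, t, 1] [x, y, z, t, 1]) : wordP x y z t = 1 := by
  rw [conn_deltaFourth] at h
  simp only [List.map_cons, List.map_nil, List.cons.injEq] at h
  have h4 := h.2.2.2.1
  calc wordP x y z t = alternating x y z t 1 * (alternating 1 t z y x)⁻¹ * t *
        (alternating x y z t 1)⁻¹ * alternating 1 t z y x * t⁻¹ := by
        simp [wordP, alternating, mul_assoc]
    _ = 1 := by rw [← h4, mul_inv_cancel]

/-- In a commutative group both alternating products coincide, so `Δ₅⁴` acts trivially. -/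
theorem conn_deltaFourth_of_comm {H : Type*} [CommGroup H] {t : List H} (ht : t.length = 5) :
    Conn deltaFourth.slices t t := by
  obtain ⟨a, t, rfl, h4⟩ := exists_cons_of_le (n := 4) ht.ge
  obtain ⟨b, t, rfl, h3⟩ := exists_cons_of_le (n := 3) (by omega)
  obtain ⟨c, t, rfl, h2⟩ := exists_cons_of_le (n := 2) (by omega)
  obtain ⟨d, t, rfl, h1⟩ := exists_cons_of_le (n := 1) (by omega)
  obtain ⟨e, t, rfl, h0⟩ := exists_cons_of_le (n := 0) (by omega)
  obtain rfl : t = [] := by simpa using ht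
  rw [conn_deltaFourth]
  have h : alternating e d c b a = alternating a b c d e := by
    simp only [alternating]
    rw [mul_comm, mul_comm (e * d⁻¹ * c), mul_comm (e * d⁻¹), mul_comm e]
    simp only [mul_assoc]
  simp [h]

theorem card_vector_subtype {H : Type*} (n : ℕ) (p : List H → Prop) :
    Nat.card {t : List H // t.length = n ∧ p t} = Nat.card {v : List.Vector H n // p v.1} :=
  Nat.card_congr (Equiv.subtypeSubtypeEquivSubtypeInter (fun t : List H => t.length = n) p).symm

theorem card_vector (H : Type*) [Finite H] (n : ℕ) :
    Nat.card (List.Vector H n) = Nat.card H ^ n := by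
  have := Fintype.ofFinite H
  rw [Nat.card_eq_fintype_card, Nat.card_eq_fintype_card, _root_.card_vector]

theorem card_colors_deltaFourth_of_comm (H : Type*) [CommGroup H] [Finite H] :
    Nat.card {ms : List (List H) // Colors deltaFourth.closure.word [] ms []} =
      Nat.card H ^ 5 := by
  rw [card_colors_closure, card_vector_subtype, ← card_vector]
  exact Nat.card_congr (Equiv.subtypeUnivEquiv fun v => conn_deltaFourth_of_comm v.2)

/-- The witness of `P ≠ 1`, completed by a fifth color `1`, is not a fixed point. -/
theorem card_colors_deltaFourth_lt :
    Nat.card {ms : List (List ExteriorAffine) // Colors deltaFourth.closure.word [] ms []} <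
      Nat.card ExteriorAffine ^ 5 := by
  rw [card_colors_closure, card_vector_subtype, ← card_vector]
  have := Fintype.ofFinite ExteriorAffine
  refine Finite.card_subtype_lt (x := ⟨[1, ⟨0, 0, 0, 1, 0, 0, 0⟩, ⟨1, 0, 0, 0, 0, 0, 0⟩,
    ⟨0, 1, 0, 0, 0, 0, 0⟩, 1], rfl⟩) fun h => ?_
  exact ExteriorAffine.wordP_ne_one (wordP_eq_one_of_conn h)

/-! ### Colorings of trivial links -/

theorem card_colors_trivialLink (n : ℕ) :
    Nat.card {ms : List (List H) // Colors (trivialLink n).word [] ms []} = Nat.card H ^ n := by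
  induction n with
  | zero =>
    have : {ms : List (List H) // Colors (trivialLink 0).word [] ms []} ≃ Unit :=
      ⟨fun _ => (), fun _ => ⟨[], rfl, rfl⟩, fun ⟨ms, h⟩ => Subtype.ext h.1.symm, fun _ => rfl⟩
    rw [Nat.card_congr this]
    simp
  | succ n ih =>
    have h1 : ∀ ms : List (List H), Colors (trivialLink (n + 1)).word [] ms [] ↔
        ∃ (a : H) (ms' : List (List H)), ms = [a, a] :: [] :: ms' ∧
          Colors (trivialLink n).word [] ms' [] := by
      intro ms
      change Colors (cup 0 :: cap 0 :: (trivialLink n).word) [] ms [] ↔ _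
      constructor
      · rintro ⟨_, _, rfl, ⟨a, rfl⟩, m, ms', rfl, ⟨b, hm⟩, h⟩
        simp only [List.cons.injEq] at hm
        obtain ⟨rfl, -, rfl⟩ := hm
        exact ⟨a, ms', rfl, h⟩
      · rintro ⟨a, ms', rfl, h⟩
        exact ⟨_, _, rfl, ⟨a, rfl⟩, _, _, rfl, ⟨a, rfl⟩, h⟩
    rw [pow_succ', ← ih, ← Nat.card_prod]
    refine (Nat.card_congr (Equiv.ofBijective (fun x : H ×
      {ms : List (List H) // Colors (trivialLink n).word [] ms []} =>
      (⟨[x.1, x.1] :: [] :: x.2.1, (h1 _).2 ⟨x.1, x.2.1, rfl, x.2.2⟩⟩ :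
      {ms : List (List H) // Colors (trivialLink (n + 1)).word [] ms []})) ⟨?_, ?_⟩)).symm
    · rintro ⟨a, ms, _⟩ ⟨b, ms', _⟩ h
      simp only [Subtype.mk.injEq, List.cons.injEq] at h
      obtain ⟨⟨rfl, -⟩, -, rfl⟩ := h
      rfl
    · rintro ⟨ms, h⟩
      obtain ⟨a, ms', rfl, h'⟩ := (h1 ms).1 h
      exact ⟨⟨a, ms', h'⟩, rfl⟩

/-- The homomorphisms to groups of exponent three distinguish Chen's link from trivial links. -/
theorem not_card_hom_eq (n : ℕ) :
    ¬ ∀ (H : Type) [Group H] [Finite H], (∀ h : H, h ^ 3 = 1) →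
      Nat.card (CoreBurnside 3 deltaFourth.closure →* H) =
        Nat.card (CoreBurnside 3 (trivialLink n) →* H) := by
  intro h
  have hexp : ∀ h : Multiplicative (ZMod 3), h ^ 3 = 1 := by decide
  have h1 := h (Multiplicative (ZMod 3)) hexp
  have h2 := h ExteriorAffine ExteriorAffine.pow_three_eq_one
  rw [card_coreBurnside_hom hexp, card_coreBurnside_hom hexp, card_colors_deltaFourth_of_comm,
    card_colors_trivialLink] at h1
  have hc : 1 < Nat.card (Multiplicative (ZMod 3)) := by simp
  -- The abelian count forces `n = 5`; the count in `ExteriorAffine` then gives the contradiction.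
  obtain rfl := Nat.pow_right_injective hc h1
  rw [card_coreBurnside_hom ExteriorAffine.pow_three_eq_one,
    card_coreBurnside_hom ExteriorAffine.pow_three_eq_one, card_colors_trivialLink] at h2
  exact card_colors_deltaFourth_lt.ne h2

end DeltaFourth
/-! ### The Burnside group of the closure of `Δ₅⁴` as a quotient of `B(4, 3)` -/

section Generation

variable {H : Type*} [Group H]

theorem SliceRel.mem_top {R : Subgroup H} {i : ℕ} {k : Kind} (hk : k ≠ .cup) {x y : List H}
    (h : SliceRel i k x y) (hx : ∀ a ∈ x, a ∈ R) : ∀ a ∈ y, a ∈ R := by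
  induction i generalizing x y with
  | zero =>
    match k, h with
    | .cap, ⟨a, h⟩ => subst h; simp_all
    | .crossing true, ⟨a, b, q, h, h'⟩ =>
      subst h h'
      simp only [List.mem_cons, forall_eq_or_imp] at hx ⊢
      exact ⟨mul_mem (mul_mem hx.1 (inv_mem hx.2.1)) hx.1, hx.1, hx.2.2⟩
    | .crossing false, ⟨a, b, q, h, h'⟩ =>
      subst h h'
      simp only [List.mem_cons, forall_eq_or_imp] at hx ⊢
      exact ⟨hx.2.1, mul_mem (mul_mem hx.2.1 (inv_mem hx.1)) hx.2.1, hx.2.2⟩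
  | succ i ih =>
    obtain ⟨c, x', y', rfl, rfl, h⟩ := h
    simp only [List.mem_cons, forall_eq_or_imp] at hx ⊢
    exact ⟨hx.1, ih h hx.2⟩

theorem Colors.mem_top {R : Subgroup H} {w : List Slice} (hw : ∀ s ∈ w, s.kind ≠ .cup)
    {x y : List H} {ms : List (List H)} (h : Colors w x ms y) (hx : ∀ a ∈ x, a ∈ R) :
    ∀ m ∈ ms, ∀ a ∈ m, a ∈ R := by
  induction w generalizing x ms with
  | nil => obtain ⟨rfl, rfl⟩ := h; simp
  | cons s w ih =>
    obtain ⟨m, ms', rfl, h1, h2⟩ := h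
    have hm := h1.mem_top (hw s (by simp)) hx
    simp only [List.mem_cons, forall_eq_or_imp]
    exact ⟨hm, ih (fun s hs => hw s (by simp [hs])) h2 hm⟩

/-- Minima only add strands, so every color below is still present at the top. -/
theorem mem_of_colors_closingCups {R : Subgroup H} {n : ℕ} {y : List H} {ms : List (List H)}
    (h : Colors (closingCups n) [] ms y) (hy : ∀ a ∈ y, a ∈ R) : ∀ m ∈ ms, ∀ a ∈ m, a ∈ R := by
  induction n generalizing y ms with
  | zero => obtain ⟨rfl, rfl⟩ := h; simp
  | succ n ih =>
    rw [closingCups, List.range_succ, List.map_append] at h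
    obtain ⟨m₁, m₂, z, rfl, h1, h2⟩ := colors_append.1 h
    obtain ⟨m, _, rfl, h3, rfl, rfl⟩ := h2
    obtain ⟨t, ht, rfl⟩ := conn_closingCups.1 h1.conn
    obtain ⟨y', rfl, a, rfl⟩ := (sliceRel_append_left (j := 0) ht).1 h3
    have hz : ∀ b ∈ t ++ t.reverse, b ∈ R := fun b hb => hy b (by simp at hb ⊢; tauto)
    intro m hm
    rcases List.mem_append.1 hm with hm | hm
    · exact ih h1 hz m hm
    · rw [List.mem_singleton.1 hm]; exact hy

/-- A subgroup containing the colors at the bottom of a closed braid contains all colors. -/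
theorem Colors.mem_closure {R : Subgroup H} {N : ℕ} {b : BraidWord N} {ms : List (List H)}
    (h : Colors b.closure.word [] ms []) (hR : ∀ a ∈ (level ms N).take N, a ∈ R) :
    ∀ m ∈ ms, ∀ a ∈ m, a ∈ R := by
  obtain ⟨m₁, m₂, m₃, t, rfl, ht, -, h1, h2, h3⟩ := colors_closure h
  rw [level_closure h1, List.take_left' ht] at hR
  have hz : ∀ b ∈ t ++ t.reverse, b ∈ R := fun b hb => hR b (by simpa using hb)
  intro m hm
  simp only [List.mem_append] at hm
  rcases hm with (hm | hm) | hm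
  · exact mem_of_colors_closingCups h1 hz m hm
  · exact h2.mem_top kind_slices hz m hm
  · exact h3.mem_top kind_closingCaps hz m hm

theorem getD_level_mem {R : Subgroup H} {ms : List (List H)} (h : ∀ m ∈ ms, ∀ a ∈ m, a ∈ R)
    (k j : ℕ) : (level ms k).getD j 1 ∈ R := by
  have h' : ∀ m ∈ ([] : List H) :: ms, ∀ a ∈ m, a ∈ R := by simpa using h
  have getD_mem : ∀ {α : Type _} {x : List α} {a : α} {P : α → Prop}, (∀ b ∈ x, P b) → P a →
      ∀ i, P (x.getD i a) := by
    intro α x a P hx ha i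
    by_cases hi : i < x.length
    · rw [List.getD_eq_getElem _ _ hi]
      exact hx _ (List.getElem_mem hi)
    · rwa [List.getD_eq_default _ _ (by omega)]
  have h2 : ∀ a ∈ level ms k, a ∈ R := getD_mem (P := fun m => ∀ a ∈ m, a ∈ R) h' (by simp) k
  exact getD_mem (P := fun a => a ∈ R) h2 (one_mem R) j

end Generation

theorem eq_top_of_linkArc_mem {n : ℕ} {D : LinkDiagram} {e : Strand D}
    {R : Subgroup (LinkBurnside n D e)} (h : ∀ p, linkArc n e p ∈ R) : R = ⊤ := by
  let π : CoreGroup D →* LinkBurnside n D e := (QuotientGroup.mk' _).comp (QuotientGroup.mk' _)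
  have hπ : Function.Surjective π :=
    (QuotientGroup.mk'_surjective _).comp (QuotientGroup.mk'_surjective _)
  have h1 : R.comap π = ⊤ := by
    rw [eq_top_iff, ← PresentedGroup.closure_range_of, Subgroup.closure_le]
    rintro _ ⟨p, rfl⟩
    exact h p
  rw [← Subgroup.map_comap_eq_self_of_surjective hπ R, h1,
    Subgroup.map_top_of_surjective π hπ]

theorem elementP_map {G : Type*} [Group G] (φ : FreeBurnside 4 3 →* G) :
    φ elementP = wordP (φ (FreeBurnside.gen 4 3 0)) (φ (FreeBurnside.gen 4 3 1))
      (φ (FreeBurnside.gen 4 3 2)) (φ (FreeBurnside.gen 4 3 3)) :=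
  map_wordP φ _ _ _ _

theorem exists_freeBurnside_hom {n r : ℕ} {G : Type*} [Group G] (hG : ∀ g : G, g ^ n = 1)
    (f : Fin r → G) : ∃ φ : FreeBurnside r n →* G, ∀ i, φ (FreeBurnside.gen r n i) = f i :=
  ⟨BurnsideQuotient.lift hG (FreeGroup.lift f), fun i => by
    rw [FreeBurnside.gen, BurnsideQuotient.lift_mk, FreeGroup.lift_apply_of]⟩

theorem exists_surjective_deltaFourth : ∃ (e : Strand deltaFourth.closure)
    (φ : FreeBurnside 4 3 →* LinkBurnside 3 deltaFourth.closure e),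
    Function.Surjective φ ∧ φ elementP = 1 := by
  have hlen : (5 : ℕ) ≤ deltaFourth.closure.word.length := by decide
  have hwidth : width (deltaFourth.closure.word.take 5) 0 = some 10 := by decide
  -- Line `5` lies just above the five minima, and position `4` is the last strand of the braid, so
  -- the fifth bottom color becomes `1` and the other four generate.
  let e : Strand deltaFourth.closure := ⟨5, 4, 10, hwidth, by decide⟩
  let ms := (burnsideColors 3 deltaFourth.closure).map (List.map (burnsideProj 3 e))
  have hms : Colors deltaFourth.closure.word [] ms [] :=
    (colors_burnsideColors 3 deltaFourth.closure).map (burnsideProj 3 e)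
  have hcolor : ∀ p : Strand deltaFourth.closure,
      (level ms p.level).getD p.pos 1 = linkArc 3 e p :=
    fun p => level_map_burnsideColors_getD (burnsideProj 3 e) p
  obtain ⟨t, ht, htake, hconn⟩ : ∃ t, t.length = 5 ∧ (∃ q, level ms 5 = t ++ q) ∧
      Conn deltaFourth.slices t t := by
    obtain ⟨m₁, m₂, m₃, t, h, ht, hc, h1, -, -⟩ := colors_closure hms
    exact ⟨t, ht, ⟨_, h ▸ level_closure h1⟩, hc⟩
  obtain ⟨q, hq⟩ := htake
  obtain ⟨x, t, rfl, -⟩ := exists_cons_of_le (n := 4) ht.ge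
  obtain ⟨y, t, rfl, -⟩ := exists_cons_of_le (n := 3) (x := t) (by simp at ht; omega)
  obtain ⟨z, t, rfl, -⟩ := exists_cons_of_le (n := 2) (x := t) (by simp at ht; omega)
  obtain ⟨w, t, rfl, -⟩ := exists_cons_of_le (n := 1) (x := t) (by simp at ht; omega)
  obtain ⟨v, t, rfl, -⟩ := exists_cons_of_le (n := 0) (x := t) (by simp at ht; omega)
  obtain rfl : t = [] := by simpa using ht
  have hv : v = 1 := by
    have := hcolor e
    rw [linkArc_self, show level ms e.level = _ from hq] at this
    exact this
  subst hv
  obtain ⟨φ, hφ⟩ := exists_freeBurnside_hom (n := 3) BurnsideQuotient.pow_eq_one ![x, y, z, w]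
  refine ⟨e, φ, ?_, ?_⟩
  · rw [← MonoidHom.range_eq_top]
    apply eq_top_of_linkArc_mem
    intro p
    have hmem : ∀ m ∈ ms, ∀ a ∈ m, a ∈ φ.range := by
      refine hms.mem_closure ?_
      rw [hq]
      intro a ha
      simp only [List.cons_append, List.nil_append, List.take_succ_cons, List.take_zero,
        List.mem_cons, List.not_mem_nil, or_false] at ha
      rcases ha with rfl | rfl | rfl | rfl | rfl
      · exact ⟨_, hφ 0⟩
      · exact ⟨_, hφ 1⟩
      · exact ⟨_, hφ 2⟩
      · exact ⟨_, hφ 3⟩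
      · exact one_mem _
    rw [← hcolor p]
    exact getD_level_mem hmem _ _
  · rw [elementP_map, hφ, hφ, hφ, hφ]
    exact wordP_eq_one_of_conn hconn

end LinkDiag

/-! ### The theorem for Chen's link -/

open LinkDiag in
theorem mainTheorem7 :
    -- Chen's link is 3-move equivalent to the closure of `Δ₅⁴`
    MoveEquiv 3 chenLink deltaFourth.closure ∧
    -- the third Burnside group is invariant under 3-moves, in the unreduced version,
    -- and in the reduced version whatever arcs are put equal to `1`
    (∀ D E : LinkDiagram, MoveEquiv 3 D E →
      Nonempty (CoreBurnside 3 D ≃* CoreBurnside 3 E) ∧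
      ∀ (d : Strand D) (e : Strand E), Nonempty (LinkBurnside 3 D d ≃* LinkBurnside 3 E e)) ∧
    -- `P` is nontrivial in `B(4,3)`, but it dies in the Burnside group of Chen's link,
    -- which is a quotient of `B(4,3)`
    elementP ≠ 1 ∧
    (∀ e : Strand chenLink, ∃ φ : FreeBurnside 4 3 →* LinkBurnside 3 chenLink e,
      Function.Surjective φ ∧ φ elementP = 1) ∧
    -- the third Burnside group of Chen's link differs from that of any trivial link
    (∀ n : ℕ, IsEmpty (CoreBurnside 3 chenLink ≃* CoreBurnside 3 (trivialLink n)) ∧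
      ∀ (d : Strand chenLink) (e : Strand (trivialLink n)),
        IsEmpty (LinkBurnside 3 chenLink d ≃* LinkBurnside 3 (trivialLink n) e)) ∧
    -- Chen's link is not 3-move equivalent to a trivial link
    (∀ n : ℕ, ¬ MoveEquiv 3 chenLink (trivialLink n)) ∧
    -- the Montesinos–Nakanishi conjecture fails
    ¬ ∀ D : LinkDiagram, ∃ n : ℕ, MoveEquiv 3 D (trivialLink n) := by
  have hinv : ∀ D E : LinkDiagram, MoveEquiv 3 D E →
      Nonempty (CoreBurnside 3 D ≃* CoreBurnside 3 E) ∧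
      ∀ (d : Strand D) (e : Strand E), Nonempty (LinkBurnside 3 D d ≃* LinkBurnside 3 E e) :=
    fun D E h => ⟨(h.burnside_equiv (by decide)).1, (h.burnside_equiv (by decide)).2.1⟩
  obtain ⟨⟨f⟩, hred⟩ := hinv _ _ moveEquiv_chenLink
  obtain ⟨e₀, φ, hφ, hP⟩ := exists_surjective_deltaFourth
  have hcore : ∀ n : ℕ, IsEmpty (CoreBurnside 3 chenLink ≃* CoreBurnside 3 (trivialLink n)) := by
    refine fun n => ⟨fun g => not_card_hom_eq n fun H _ _ _ => ?_⟩
    exact Nat.card_congr (f.symm.trans g).monoidHomCongrLeftEquiv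
  have hmove : ∀ n : ℕ, ¬ MoveEquiv 3 chenLink (trivialLink n) := fun n h =>
    (hcore n).elim (hinv _ _ h).1.some
  refine ⟨moveEquiv_chenLink, hinv, elementP_ne_one, fun e => ?_, fun n => ⟨hcore n, ?_⟩, hmove,
    fun h => ?_⟩
  -- The surjection was built for one arc of the closure of `Δ₅⁴`; invariance transports it to any
  -- arc of Chen's link.
  · obtain ⟨g⟩ := hred e e₀
    exact ⟨g.symm.toMonoidHom.comp φ, g.symm.surjective.comp hφ, by simp [hP]⟩
  · refine fun d e => ⟨fun g => not_card_hom_eq n fun H _ _ hH => ?_⟩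
    obtain ⟨g₀⟩ := hred d e₀
    -- An isomorphism of reduced groups would equalize the unreduced counts as well, since both
    -- carry the same factor `|H|`.
    rw [card_coreBurnside_hom_eq_mul hH e₀, card_coreBurnside_hom_eq_mul hH e,
      Nat.card_congr (g₀.symm.trans g).monoidHomCongrLeftEquiv]
  · obtain ⟨n, hn⟩ := h chenLink
    exact hmove n hn
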